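/- **Setting.** A category is *homological* if it is pointed, finitely complete, regular and protomodular (i.e. the Split Short Five Lemma holds); it is *semi-abelian* if moreover it is Barr-exact and has binary coproducts. Let $$\mathcal F \underset{U}{\overset{F}{\leftrightarrows}} \mathcal B \underset{H}{\overset{I}{\leftrightarrows}} \mathcal A,\qquad F\dashv U,\quad I\dashv H,$$ where $\mathcal A$ is semi-abelian, $H$ and $U$ are inclusions of full (replete) subcategories, and * $\mathcal B$ is a Birkhoff subcategory of $\mathcal A$: the components of the unit $\eta^1$ of $I\dashv H$ are regular epimorphisms in $\mathcal A$, and $\mathcal B$ is closed under regular quotients in $\mathcal A$; * $\mathcal F$ is regular epi-reflective in $\mathcal B$: the components of the unit $\eta^2$ of $F\dashv U$ are regular epimorphisms in $\mathcal B$; * $\mathcal F$ is admissible in $\mathcal B$ for regular epimorphisms: for every $X\in\mathcal B$ and every $\varphi\colon Y\to F(X)$ in $\mathcal F$ such that $U(\varphi)$ is a regular epimorphism in $\mathcal B$, the canonical morphism $F(X\times_{UF(X)}U(Y))\to FU(Y)\to Y$ is an isomorphism; * $F$ is protoadditive: it preserves split short exact sequences. Write $\eta$ for the unit of the composite adjunction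 $F\circ I\dashv H\circ U$, and $K[g]$ for the kernel of a morphism $g$. **Fundamental group.** An *$\mathcal F$-trivial extension* is a regular epimorphism $g\colon E\to B$ in $\mathcal A$ whose naturality square for $\eta$ is a pullback. A *monadic extension* is a regular epimorphism $p\colon E\to B$ in $\mathcal A$ such that pulling back along $p$ is a monadic functor from the regular epimorphisms over $B$ to the regular epimorphisms over $E$ (full subcategories of the slices). An *$\mathcal F$-normal extension* is a monadic extension $p\colon E\to B$ such that the kernel pair projection $E\times_BE\to E$ is an $\mathcal F$-trivial extension. It is *weakly universal* if for every $\mathcal F$-normal extension $p'\colon E'\to B$ there is $u\colon E\to E'$ with $p'u=p$. The fundamental group $\pi_1(B)$ is (the underlying object of) the Galois group $$\mathrm{Gal}(E,p,0)=\ker\big(\langle FI(\pi_1),FI(\pi_2)\rangle\colon FI(E\times_BE)\to FI(E)\times FI(E)\big)$$ of a weakly universal $\mathcal F$-normal extension $p\colon E\to B$. **Closure and commutator.** For a normal subobject $N$ of $A\in\mathcal A$ with quotient map $q\colon A\to A/N$, its homological closure is $\overline{N}^{\mathcal F}_A=q^{-1}(K[\eta_{A/N}])$. For a regular epimorphism $f\colon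 A\to B$ in $\mathcal A$ with kernel pair projections $\pi_1,\pi_2\colon R[f]\to A$, the relative commutator $[K[f],A]_{\mathcal B}$ is the kernel of the restriction $K[\eta^1_{R[f]}]\to K[\eta^1_A]$ of $\pi_1$; it is a subobject of $A$ through $\pi_2$, contained and normal in $K[f]$. For $f\colon A\to 0$ this gives $[A,A]_{\mathcal B}$, a normal subobject of $A$. **Theorem.** Let $f\colon P\to B$ be a projective presentation in $\mathcal A$, that is, a regular epimorphism whose domain $P$ is projective with respect to regular epimorphisms. Then $B$ has a weakly universal $\mathcal F$-normal extension, the subobject $\overline{([K[f],P]_{\mathcal B})}^{\mathcal F}_{K[f]}$ is contained and normal in $K[f]\wedge\overline{([P,P]_{\mathcal B})}^{\mathcal F}_{P}$, and for every weakly universal $\mathcal F$-normal extension of $B$ (that is, whichever one is used to define $\pi_1(B)$) $$\pi_1(B)\;\cong\;\frac{K[f]\wedge\overline{([P,P]_{\mathcal B})}^{\mathcal F}_{P}}{\overline{([K[f],P]_{\mathcal B})}^{\mathcal F}_{K[f]}}$$ in $\mathcal A$. -/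

import Mathlib

open CategoryTheory CategoryTheory.Limits

universe v₁ v₂ u₁ u₂

namespace SemiAbelianHopf

noncomputable section

section Exactness

variable {C : Type u₁} [Category.{v₁} C] [HasZeroMorphisms C]

/-- A normal monomorphism: a kernel of some morphism. -/
class IsNormalMono {K A : C} (k : K ⟶ A) : Prop where
  normalMono : Nonempty (NormalMono k)

/-- A short exact sequence `0 ⟶ K ⟶ A ⟶ B ⟶ 0`: `k` is a kernel of `f` and `f` is a cokernel
of `k`. -/
structure IsShortExact {K A B : C} (k : K ⟶ A) (f : A ⟶ B) : Prop where
  w : k ≫ f = 0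
  isKernel : Nonempty (IsLimit (KernelFork.ofι k w))
  isCokernel : Nonempty (IsColimit (CokernelCofork.ofπ f w))

/-- A split short exact sequence, with chosen splitting `s`. -/
structure IsSplitShortExact {K A B : C} (k : K ⟶ A) (f : A ⟶ B) (s : B ⟶ A) : Prop
    extends IsShortExact k f where
  splitting : s ≫ f = 𝟙 B

variable (C) in
/-- The Split Short Five Lemma: in a morphism between two split epimorphisms with chosen sections
and kernels, the middle component is invertible as soon as the outer ones are. -/
def SplitShortFiveLemma : Prop :=
  ∀ ⦃K A B K' A' B' : C⦄ (k : K ⟶ A) (f : A ⟶ B) (s : B ⟶ A)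
    (k' : K' ⟶ A') (f' : A' ⟶ B') (s' : B' ⟶ A') (u : K ⟶ K') (v : A ⟶ A') (w : B ⟶ B')
    (hk : k ≫ f = 0) (hk' : k' ≫ f' = 0),
    Nonempty (IsLimit (KernelFork.ofι k hk)) → Nonempty (IsLimit (KernelFork.ofι k' hk')) →
    s ≫ f = 𝟙 B → s' ≫ f' = 𝟙 B' →
    k ≫ v = u ≫ k' → f ≫ w = v ≫ f' → s ≫ v = w ≫ s' →
    IsIso u → IsIso w → IsIso v

variable (C) in
/-- A homological category: pointed, finitely complete, regular and protomodular. For a pointed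
finitely complete category protomodularity is the Split Short Five Lemma. -/
class Homological : Prop extends Regular C, HasZeroObject C where
  splitShortFive : SplitShortFiveLemma C

variable (C) in
/-- A semi-abelian category: homological, Barr-exact, with binary coproducts. -/
class SemiAbelian : Prop extends Homological C, HasBinaryCoproducts C where
  effective : ∀ ⦃R X : C⦄ (p₁ p₂ : R ⟶ X),
    IsEquivalenceRelation p₁ p₂ → IsEffectiveEquivalenceRelation p₁ p₂

/-- In a homological category a regular epimorphism identifies every map that kills its kernel. -/
theorem regularEpi_desc_condition [Homological C] {A B : C} (f : A ⟶ B) {K : C} (k : K ⟶ A)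
    (hk : k ≫ f = 0) (hlim : IsLimit (KernelFork.ofι k hk)) {Z : C} (g : A ⟶ Z)
    (hg : k ≫ g = 0) : pullback.fst f f ≫ g = pullback.snd f f ≫ g := by
  let j : K ⟶ pullback f f := pullback.lift 0 k (by simp [hk])
  let d : A ⟶ pullback f f := pullback.lift (𝟙 A) (𝟙 A) rfl
  let e := equalizer.ι (pullback.fst f f ≫ g) (pullback.snd f f ≫ g)
  let j' : K ⟶ equalizer (pullback.fst f f ≫ g) (pullback.snd f f ≫ g) :=
    equalizer.lift j (by
      rw [← Category.assoc, ← Category.assoc, pullback.lift_fst, pullback.lift_snd, hg,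
        zero_comp])
  let d' : A ⟶ equalizer (pullback.fst f f ≫ g) (pullback.snd f f ≫ g) :=
    equalizer.lift d (by
      rw [← Category.assoc, ← Category.assoc, pullback.lift_fst, pullback.lift_snd])
  have hj'e : j' ≫ e = j := equalizer.lift_ι _ _
  have hd'e : d' ≫ e = d := equalizer.lift_ι _ _
  have hj : j ≫ pullback.fst f f = 0 := pullback.lift_fst _ _ _
  have hjs : j ≫ pullback.snd f f = k := pullback.lift_snd _ _ _
  have hmk : Mono k := mono_of_isLimit_fork hlim
  have hmj : Mono j := by
    have : Mono (j ≫ pullback.snd f f) := by rw [hjs]; infer_instance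
    exact mono_of_mono j (pullback.snd f f)
  have hmj' : Mono j' := by
    have : Mono (j' ≫ e) := by rw [hj'e]; infer_instance
    exact mono_of_mono j' e
  have hw : j' ≫ (e ≫ pullback.fst f f) = 0 := by rw [← Category.assoc, hj'e, hj]
  have key : ∀ {T : C} (t : T ⟶ pullback f f), t ≫ pullback.fst f f = 0 →
      ∃ l : T ⟶ K, l ≫ j = t := by
    intro T t ht
    have h1 : (t ≫ pullback.snd f f) ≫ f = 0 := by
      rw [Category.assoc, ← pullback.condition, ← Category.assoc, ht, zero_comp]
    obtain ⟨l, hl⟩ := KernelFork.IsLimit.lift' hlim _ h1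
    refine ⟨l, pullback.hom_ext ?_ ?_⟩
    · rw [Category.assoc, hj, comp_zero, ht]
    · rw [Category.assoc, hjs]; exact hl
  have lim : IsLimit (KernelFork.ofι j hj) :=
    KernelFork.IsLimit.ofι' j hj fun t ht =>
      ⟨(key t ht).choose, (key t ht).choose_spec⟩
  have lim' : IsLimit (KernelFork.ofι j' hw) :=
    KernelFork.IsLimit.ofι' j' hw fun t ht => by
      have h := key (t ≫ e) (by rw [Category.assoc]; exact ht)
      refine ⟨h.choose, ?_⟩
      rw [← cancel_mono e, Category.assoc, hj'e]
      exact h.choose_spec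
  have hiso : IsIso e :=
    Homological.splitShortFive j' (e ≫ pullback.fst f f) d' j (pullback.fst f f) d (𝟙 K) e (𝟙 A)
      hw hj ⟨lim'⟩ ⟨lim⟩ (by rw [← Category.assoc, hd'e]; exact pullback.lift_fst _ _ _)
      (pullback.lift_fst _ _ _) (by rw [hj'e, Category.id_comp]) (by simp)
      (by rw [hd'e, Category.id_comp]) inferInstance inferInstance
  rw [← cancel_epi e]
  exact equalizer.condition _ _

/-- In a homological category every normal subobject `K` of `A` has a quotient `A ⟶ A/K`. -/
instance hasCokernel_of_isNormalMono [Homological C] {K A : C} (k : K ⟶ A) [h : IsNormalMono k] :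
    HasCokernel k := by
  obtain ⟨N⟩ := h.normalMono
  let φ := Regular.strongEpiMonoFactorisation N.g
  have hke : k ≫ φ.e = 0 := by
    rw [← cancel_mono φ.m, Category.assoc, φ.fac, zero_comp]; exact N.w
  have lim : IsLimit (KernelFork.ofι k hke) :=
    have : Mono k := mono_of_isLimit_fork N.isLimit
    KernelFork.IsLimit.ofι' k hke fun t ht =>
      KernelFork.IsLimit.lift' N.isLimit t (by rw [← φ.fac, ← Category.assoc, ht, zero_comp])
  have hreg : IsRegularEpi φ.e := inferInstance
  obtain ⟨r⟩ := hreg.regularEpi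
  have := r.epi
  have col : IsColimit (CokernelCofork.ofπ φ.e hke) :=
    CokernelCofork.IsColimit.ofπ' φ.e hke fun g hg =>
      Cofork.IsColimit.desc' r.isColimit g (by
        have hc := regularEpi_desc_condition φ.e k hke lim g hg
        have h1 : pullback.lift r.left r.right r.w ≫ pullback.fst φ.e φ.e = r.left :=
          pullback.lift_fst _ _ _
        have h2 : pullback.lift r.left r.right r.w ≫ pullback.snd φ.e φ.e = r.right :=
          pullback.lift_snd _ _ _
        calc r.left ≫ g = (pullback.lift r.left r.right r.w ≫ pullback.fst φ.e φ.e) ≫ g := by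
              rw [h1]
          _ = (pullback.lift r.left r.right r.w ≫ pullback.snd φ.e φ.e) ≫ g := by
              rw [Category.assoc, hc, Category.assoc]
          _ = r.right ≫ g := by rw [h2])
  exact HasColimit.mk ⟨_, col⟩

/-- An object `P` is (regular) projective: it is projective with respect to the class of regular
epimorphisms. -/
def IsRegularProjective (P : C) : Prop :=
  ∀ ⦃X Y : C⦄ (e : X ⟶ Y) (g : P ⟶ Y), IsRegularEpi e → ∃ h : P ⟶ X, h ≫ e = g

/-- A projective presentation of `B`: a regular epimorphism `f : P ⟶ B` with `P` projective. -/
structure IsProjectivePresentation {P B : C} (f : P ⟶ B) : Prop where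
  regularEpi : IsRegularEpi f
  projective : IsRegularProjective P

end Exactness

section Reflections

variable {C : Type u₁} [Category.{v₁} C] {D : Type u₂} [Category.{v₂} D]
variable {L : C ⥤ D} {R : D ⥤ C} (adj : L ⊣ R)

/-- The unit `η_X : X ⟶ R L X` of a reflection. -/
def unitAt (X : C) : X ⟶ R.obj (L.obj X) := adj.unit.app X

theorem unitAt_naturality {X Y : C} (g : X ⟶ Y) :
    unitAt adj X ≫ R.map (L.map g) = g ≫ unitAt adj Y :=
  (adj.unit.naturality g).symm

/-- A full subcategory `R : D ⥤ C` with reflector `L` is regular epi-reflective if every component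
of the unit is a regular epimorphism of `C`. -/
structure IsRegularEpiReflective [R.Full] [R.Faithful] : Prop where
  regularEpi_unit : ∀ X : C, IsRegularEpi (unitAt adj X)

/-- A Birkhoff subcategory: a full regular epi-reflective subcategory which is closed under
regular quotients. -/
structure IsBirkhoff [R.Full] [R.Faithful] : Prop extends IsRegularEpiReflective adj where
  quotient_closed : ∀ ⦃X Y : C⦄ (f : X ⟶ Y), IsRegularEpi f → R.essImage X → R.essImage Y

/-- Admissibility, for the class of regular epimorphisms of `C`: for every object `B` of `C` and
every `φ : X ⟶ L B` in `D` which is a regular epimorphism in `C`, the component at `(X, φ)` of the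
counit of the induced adjunction between extensions of `B` in `C` and extensions of `L B` in `D`,
that is, `L (B ×_{R L B} R X) ⟶ L R X ⟶ X`, is an isomorphism. -/
def IsAdmissible : Prop :=
  ∀ ⦃B : C⦄ ⦃X : D⦄ (φ : X ⟶ L.obj B), IsRegularEpi (R.map φ) →
    ∀ ⦃W : C⦄ (π₁ : W ⟶ B) (π₂ : W ⟶ R.obj X),
      IsPullback π₁ π₂ (unitAt adj B) (R.map φ) →
        IsIso (L.map π₂ ≫ adj.counit.app X)

/-- A functor is protoadditive if it preserves split short exact sequences. -/
def IsProtoadditive [HasZeroMorphisms C] [HasZeroMorphisms D] (F : C ⥤ D) : Prop :=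
  ∀ ⦃K A B : C⦄ (k : K ⟶ A) (f : A ⟶ B) (s : B ⟶ A),
    IsSplitShortExact k f s → IsSplitShortExact (F.map k) (F.map f) (F.map s)

/-- A full reflective subcategory of a finitely complete category is finitely complete. -/
theorem hasFiniteLimits_of_adjunction (adj : L ⊣ R) [R.Full] [R.Faithful] [HasFiniteLimits C] :
    HasFiniteLimits D := by
  let _ : Reflective R := { L := L, adj := adj }
  exact ⟨fun _ _ _ => hasLimitsOfShape_of_reflective R⟩

end Reflections

section Extensions

variable {C : Type u₁} [Category.{v₁} C] [Regular C]

instance : (MorphismProperty.regularEpi C).IsStableUnderBaseChange :=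
  Regular.regularEpiIsStableUnderBaseChange

/-- A monadic extension: a regular epimorphism `p : E ⟶ B` such that the pullback functor `p^*`,
from the full subcategory of `C/B` on the regular epimorphisms to the full subcategory of `C/E` on
the regular epimorphisms, is monadic. -/
structure IsMonadicExtension {E B : C} (p : E ⟶ B) : Prop where
  regularEpi : IsRegularEpi p
  monadic : Nonempty (MonadicRightAdjoint
    (MorphismProperty.Over.pullback (MorphismProperty.regularEpi C) ⊤ p))

variable {D : Type u₂} [Category.{v₂} D] {L : C ⥤ D} {R : D ⥤ C} (adj : L ⊣ R)

/-- A trivial extension: a regular epimorphism whose naturality square for the unit is a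
pullback. -/
structure IsTrivialExtension {E B : C} (f : E ⟶ B) : Prop where
  regularEpi : IsRegularEpi f
  isPullback : IsPullback (unitAt adj E) f (R.map (L.map f)) (unitAt adj B)

/-- A normal extension: a monadic extension `f` such that `f^*(f)`, a projection of the kernel pair
of `f`, is a trivial extension. -/
structure IsNormalExtension {E B : C} (f : E ⟶ B) : Prop where
  monadicExtension : IsMonadicExtension f
  trivial_pullback : IsTrivialExtension adj (pullback.fst f f)

/-- A normal extension of `B` is weakly universal if it factors through every normal extension
of `B`. -/
structure IsWeaklyUniversalNormalExtension {E B : C} (p : E ⟶ B) : Prop where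
  normal : IsNormalExtension adj p
  weaklyUniversal : ∀ ⦃E' : C⦄ (p' : E' ⟶ B), IsNormalExtension adj p' →
    ∃ u : E ⟶ E', u ≫ p' = p

/-- The Galois group `Gal(E, p, 0)`, an object of the subcategory `D`: the kernel of
`⟨L π₁, L π₂⟩ : L (E ×_B E) ⟶ L E × L E`. -/
def galoisGroup [R.Full] [R.Faithful] [HasZeroMorphisms D] {E B : C} (p : E ⟶ B) : D :=
  haveI : HasFiniteLimits D := hasFiniteLimits_of_adjunction adj
  kernel (prod.lift (L.map (pullback.fst p p)) (L.map (pullback.snd p p)))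

end Extensions

section Commutators

variable {C : Type u₁} [Category.{v₁} C] [HasZeroMorphisms C] [Homological C]
variable {D : Type u₂} [Category.{v₂} D] {L : C ⥤ D} {R : D ⥤ C} (adj : L ⊣ R)

/-- The homological closure of a normal subobject `k : K ⟶ A` for the reflection `adj`: the inverse
image along `A ⟶ A/K` of the kernel of the unit `A/K ⟶ R L (A/K)`. -/
def closure {K A : C} (k : K ⟶ A) [IsNormalMono k] : Subobject A :=
  (Subobject.pullback (cokernel.π k)).obj (kernelSubobject (unitAt adj (cokernel k)))

/-- The restriction of a morphism to the kernels of the units at its domain and codomain. -/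
abbrev unitKernelMap {X Y : C} (g : X ⟶ Y) :
    kernel (unitAt adj X) ⟶ kernel (unitAt adj Y) :=
  kernel.map (unitAt adj X) (unitAt adj Y) g (R.map (L.map g)) (unitAt_naturality adj g)

/-- The relative commutator `[K[f], A]` of `f : A ⟶ B`: the kernel of the restriction of the first
projection of the kernel pair of `f` to the kernels of the units. -/
abbrev relativeCommutator {A B : C} (f : A ⟶ B) : C :=
  kernel (unitKernelMap adj (pullback.fst f f))

/-- The relative commutator `[K[f], A]` as a subobject of `A`, through the second projection of the
kernel pair. -/
def relativeCommutator.ι {A B : C} (f : A ⟶ B) : relativeCommutator adj f ⟶ A :=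
  kernel.ι (unitKernelMap adj (pullback.fst f f)) ≫ unitKernelMap adj (pullback.snd f f) ≫
    kernel.ι (unitAt adj A)

theorem unitKernelMap_comp_ι {X Y : C} (g : X ⟶ Y) :
    unitKernelMap adj g ≫ kernel.ι (unitAt adj Y) = kernel.ι (unitAt adj X) ≫ g :=
  kernel.lift_ι _ _ _

theorem relativeCommutator.ι_eq {A B : C} (f : A ⟶ B) :
    relativeCommutator.ι adj f = kernel.ι (unitKernelMap adj (pullback.fst f f)) ≫
      kernel.ι (unitAt adj (pullback f f)) ≫ pullback.snd f f := by
  rw [relativeCommutator.ι, unitKernelMap_comp_ι]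

theorem relativeCommutator.fst_eq_zero {A B : C} (f : A ⟶ B) :
    kernel.ι (unitKernelMap adj (pullback.fst f f)) ≫
      kernel.ι (unitAt adj (pullback f f)) ≫ pullback.fst f f = 0 := by
  rw [← unitKernelMap_comp_ι, ← Category.assoc, kernel.condition, zero_comp]

theorem relativeCommutator.ι_comp {A B : C} (f : A ⟶ B) :
    relativeCommutator.ι adj f ≫ f = 0 := by
  have h := congrArg (· ≫ f) (relativeCommutator.fst_eq_zero adj f)
  simp only [Category.assoc, zero_comp] at h
  rw [relativeCommutator.ι_eq, Category.assoc, Category.assoc, ← pullback.condition, h]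

/-- The relative commutator `[K[f], A]` as a subobject of `K[f]`. -/
def relativeCommutator.toKernel {A B : C} (f : A ⟶ B) : relativeCommutator adj f ⟶ kernel f :=
  kernel.lift f (relativeCommutator.ι adj f) (relativeCommutator.ι_comp adj f)

/-- `[K[f], A]` is the kernel of `K[f] ⟶ A ×_B A ⟶ R L (A ×_B A)`; in particular it is normal
in `K[f]`. -/
instance relativeCommutator.isNormalMono_toKernel {A B : C} (f : A ⟶ B) :
    IsNormalMono (relativeCommutator.toKernel adj f) := by
  let j : kernel f ⟶ pullback f f := pullback.lift 0 (kernel.ι f) (by simp)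
  have hj₁ : j ≫ pullback.fst f f = 0 := pullback.lift_fst _ _ _
  have hj₂ : j ≫ pullback.snd f f = kernel.ι f := pullback.lift_snd _ _ _
  have hcomp : relativeCommutator.toKernel adj f ≫ j =
      kernel.ι (unitKernelMap adj (pullback.fst f f)) ≫
        kernel.ι (unitAt adj (pullback f f)) := by
    apply pullback.hom_ext
    · rw [Category.assoc, hj₁, comp_zero, Category.assoc, relativeCommutator.fst_eq_zero]
    · rw [Category.assoc, hj₂, Category.assoc, ← relativeCommutator.ι_eq]
      exact kernel.lift_ι _ _ _
  have hw : relativeCommutator.toKernel adj f ≫ (j ≫ unitAt adj (pullback f f)) = 0 := by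
    rw [← Category.assoc, hcomp, Category.assoc, kernel.condition, comp_zero]
  have hm : Mono (relativeCommutator.toKernel adj f) := by
    have : Mono (relativeCommutator.toKernel adj f ≫ j) := by
      rw [hcomp]; exact mono_comp _ _
    exact mono_of_mono _ j
  have hmj : Mono j := by
    have : Mono (j ≫ pullback.snd f f) := by rw [hj₂]; infer_instance
    exact mono_of_mono j (pullback.snd f f)
  refine ⟨⟨{ Z := _, g := j ≫ unitAt adj (pullback f f), w := hw, isLimit := ?_ }⟩⟩
  refine KernelFork.IsLimit.ofι' _ hw fun {T} t ht => ?_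
  have h₁ : (t ≫ j) ≫ unitAt adj (pullback f f) = 0 := by rw [Category.assoc]; exact ht
  refine ⟨kernel.lift _ (kernel.lift _ (t ≫ j) h₁) ?_, ?_⟩
  · rw [← cancel_mono (kernel.ι (unitAt adj A))]
    rw [Category.assoc, unitKernelMap_comp_ι, kernel.lift_ι_assoc, Category.assoc, hj₁, comp_zero,
      zero_comp]
  · rw [← cancel_mono j, Category.assoc, hcomp]
    rw [kernel.lift_ι_assoc, kernel.lift_ι]

open ZeroObject in
/-- The relative commutator `[A, A]`, obtained from `A ⟶ 0`, as a subobject of `A`. -/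
def selfCommutator.ι (A : C) : relativeCommutator adj (0 : A ⟶ (0 : C)) ⟶ A :=
  relativeCommutator.ι adj (0 : A ⟶ (0 : C))

open ZeroObject in
instance selfCommutator.isNormalMono (A : C) : IsNormalMono (selfCommutator.ι adj A) := by
  obtain ⟨N⟩ := (relativeCommutator.isNormalMono_toKernel adj (0 : A ⟶ (0 : C))).normalMono
  have hfac : relativeCommutator.toKernel adj (0 : A ⟶ (0 : C)) ≫ kernel.ι (0 : A ⟶ (0 : C)) =
      selfCommutator.ι adj A := kernel.lift_ι _ _ _
  have hm : Mono (relativeCommutator.toKernel adj (0 : A ⟶ (0 : C))) :=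
    mono_of_isLimit_fork N.isLimit
  have hm' : Mono (selfCommutator.ι adj A) := by rw [← hfac]; exact mono_comp _ _
  have hw : selfCommutator.ι adj A ≫ (inv (kernel.ι (0 : A ⟶ (0 : C))) ≫ N.g) = 0 := by
    rw [← hfac, Category.assoc, IsIso.hom_inv_id_assoc, N.w]
  refine ⟨⟨{ Z := N.Z, g := inv (kernel.ι (0 : A ⟶ (0 : C))) ≫ N.g, w := hw, isLimit := ?_ }⟩⟩
  refine KernelFork.IsLimit.ofι' _ hw fun {T} t ht => ?_
  obtain ⟨l, hl⟩ := KernelFork.IsLimit.lift' N.isLimit (t ≫ inv (kernel.ι (0 : A ⟶ (0 : C))))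
    (by rw [Category.assoc]; exact ht)
  refine ⟨l, ?_⟩
  have hl' : l ≫ relativeCommutator.toKernel adj (0 : A ⟶ (0 : C)) =
      t ≫ inv (kernel.ι (0 : A ⟶ (0 : C))) := hl
  rw [← hfac, ← Category.assoc, hl', Category.assoc, IsIso.inv_hom_id, Category.comp_id]

end Commutators

section HopfFormula

variable {A : Type u₁} [Category.{v₁} A] [HasZeroMorphisms A] [Homological A]
variable {ℬ : Type u₂} [Category.{v₂} ℬ] {I : A ⥤ ℬ} {H : ℬ ⥤ A} (adjB : I ⊣ H)
variable {ℱ : Type*} [Category* ℱ] {F' : A ⥤ ℱ} {U' : ℱ ⥤ A} (adjF : F' ⊣ U')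

/-- The numerator `K[f] ∧ cl_P [P, P]`, a subobject of `P`; the commutator is relative to `adjB`
and the closure is relative to `adjF`. -/
def hopfNumerator {P B : A} (f : P ⟶ B) : Subobject P :=
  kernelSubobject f ⊓ closure adjF (selfCommutator.ι adjB P)

/-- The denominator `cl_{K[f]} [K[f], P]`, a subobject of `K[f]` regarded as a subobject of `P`
through the inclusion of `K[f]`; the commutator is relative to `adjB` and the closure is relative
to `adjF`. -/
def hopfDenominator {P B : A} (f : P ⟶ B) : Subobject P :=
  (Subobject.map (kernel.ι f)).obj (closure adjF (relativeCommutator.toKernel adjB f))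

end HopfFormula

end

end SemiAbelianHopf

/-! Write `η¹` for the unit of `adj₁`, `η` for that of the composite reflection, and `R[f]` for the
kernel pair of `f`. Embed `K[f]` in `R[f]` as the kernel of the first projection. Then `[K[f], P]`
is `K[f] ∧ K[η¹]` computed at `R[f]`. Since that projection is split and `F` is protoadditive, its
closure `D` is `K[f] ∧ K[η]` at `R[f]` (`isKernelOf_closure_relativeCommutator`). The closure of
`[P, P]` is simply `K[η_P]`.

`D` is normal in `P`; let `q : P ⟶ E` be the quotient and `p : E ⟶ B` the map induced by `f`.
Killing `D` makes `p` normal (`isNormalExtension_quotient`): triviality is obtained for `η¹` after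
pulling back along `f`, descended along `q` by the Birkhoff property, and carried from `η¹` to `η`
by protoadditivity. By projectivity `f` lifts to any normal extension, and the lift kills `D`, so
`p` is weakly universal (`exists_fac_of_isNormalExtension`).

The Galois group of a normal extension `p` is `K[p] ∧ K[η_E]` (`exists_isKernelMeet_galoisGroup`).
Endomorphisms over `B` act trivially on `K[η_E]`, so this group does not depend on the weakly
universal extension (`nonempty_iso_of_isWeaklyUniversal`). Finally `η_P` factors through `q`, so `q`
maps `K[f] ∧ K[η_P]` onto `K[p] ∧ K[η_E]`, with kernel `D`.

Throughout, generalized elements `t : T ⟶ X`, lifted after a regular epimorphic cover of `T`,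
replace images and diagram chases. -/

namespace SemiAbelianHopf

noncomputable section

/-! ### Regular and homological categories: kernels, quotients, the Mal'tsev property. -/

section Toolkit

variable {C : Type u₁} [Category.{v₁} C]

/-- A morphism which factors through a monomorphism after precomposition with a strong epimorphism
already factors through it. -/
theorem exists_lift_of_strongEpi {Z T M Y : C} (e : Z ⟶ T) [StrongEpi e] (m : M ⟶ Y) [Mono m]
    (u : Z ⟶ M) (t : T ⟶ Y) (h : u ≫ m = e ≫ t) : ∃ l : T ⟶ M, l ≫ m = t := by
  have sq : CommSq u e m t := ⟨h⟩
  exact ⟨sq.lift, sq.fac_right⟩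

theorem exists_pullback_lift {X Y Z : C} (f : X ⟶ Z) (g : Y ⟶ Z) [HasPullback f g] {T : C}
    (a : T ⟶ X) (b : T ⟶ Y) (h : a ≫ f = b ≫ g) :
    ∃ l : T ⟶ pullback f g, l ≫ pullback.fst f g = a ∧ l ≫ pullback.snd f g = b :=
  ⟨pullback.lift a b h, pullback.lift_fst _ _ _, pullback.lift_snd _ _ _⟩

theorem exists_prod_lift {X Y : C} [HasBinaryProduct X Y] {T : C} (a : T ⟶ X) (b : T ⟶ Y) :
    ∃ l : T ⟶ X ⨯ Y, l ≫ prod.fst = a ∧ l ≫ prod.snd = b :=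
  ⟨prod.lift a b, prod.lift_fst _ _, prod.lift_snd _ _⟩

section Regular

variable [Regular C]

theorem isRegularEpi_comp {X Y Z : C} (f : X ⟶ Y) (g : Y ⟶ Z) [IsRegularEpi f] [IsRegularEpi g] :
    IsRegularEpi (f ≫ g) := inferInstance

theorem isRegularEpi_of_comp {X Y Z : C} (f : X ⟶ Y) (g : Y ⟶ Z) (h : IsRegularEpi (f ≫ g)) :
    IsRegularEpi g :=
  have := strongEpi_of_strongEpi f g
  inferInstance

theorem isRegularEpi_of_isPullback {W X Y Z : C} {f : W ⟶ X} {g : W ⟶ Y} {h : X ⟶ Z} {i : Y ⟶ Z}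
    (sq : IsPullback f g h i) (hi : IsRegularEpi i) : IsRegularEpi f :=
  Regular.regularEpiIsStableUnderBaseChange.of_isPullback sq.flip hi

/-- Every morphism factors as a regular epimorphism followed by a monomorphism. -/
theorem exists_regularEpi_mono_fac {X Y : C} (f : X ⟶ Y) :
    ∃ (J : C) (e : X ⟶ J) (m : J ⟶ Y), IsRegularEpi e ∧ Mono m ∧ e ≫ m = f :=
  ⟨_, (Regular.strongEpiMonoFactorisation f).e, (Regular.strongEpiMonoFactorisation f).m,
    inferInstance, inferInstance, (Regular.strongEpiMonoFactorisation f).fac⟩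

theorem isRegularEpi_of_section {X Y : C} (f : X ⟶ Y) (s : Y ⟶ X) (h : s ≫ f = 𝟙 Y) :
    IsRegularEpi f :=
  have : IsSplitEpi f := ⟨⟨⟨s, h⟩⟩⟩
  inferInstance

end Regular

variable [HasZeroMorphisms C]

/-- The morphism `k` is a kernel of `f`. -/
structure IsKernelOf {K A B : C} (k : K ⟶ A) (f : A ⟶ B) : Prop where
  mono : Mono k
  w : k ≫ f = 0
  lift : ∀ ⦃T : C⦄ (t : T ⟶ A), t ≫ f = 0 → ∃ l : T ⟶ K, l ≫ k = t

namespace IsKernelOf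

variable {K A B : C} {k : K ⟶ A} {f : A ⟶ B}

theorem nonempty_isLimit (h : IsKernelOf k f) : Nonempty (IsLimit (KernelFork.ofι k h.w)) :=
  have := h.mono
  ⟨KernelFork.IsLimit.ofι' k h.w fun t ht => ⟨(h.lift t ht).choose, (h.lift t ht).choose_spec⟩⟩

theorem of_isLimit {w : k ≫ f = 0} (h : IsLimit (KernelFork.ofι k w)) : IsKernelOf k f :=
  ⟨mono_of_isLimit_fork h, w, fun _ t ht => by
    obtain ⟨l, hl⟩ := KernelFork.IsLimit.lift' h t ht
    exact ⟨l, hl⟩⟩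

theorem kernel_ι (f : A ⟶ B) [HasKernel f] : IsKernelOf (kernel.ι f) f :=
  ⟨inferInstance, kernel.condition f, fun _ t ht => ⟨kernel.lift f t ht, kernel.lift_ι _ _ _⟩⟩

theorem isNormalMono (h : IsKernelOf k f) : IsNormalMono k :=
  ⟨⟨⟨_, f, h.w, h.nonempty_isLimit.some⟩⟩⟩

theorem map {D : Type*} [Category* D] [HasZeroMorphisms D] (h : IsKernelOf k f) (G : C ⥤ D)
    [G.PreservesZeroMorphisms] [PreservesLimit (parallelPair f 0) G] :
    IsKernelOf (G.map k) (G.map f) :=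
  of_isLimit (w := by rw [← G.map_comp, h.w, G.map_zero])
    (KernelFork.mapIsLimit _ h.nonempty_isLimit.some G)

end IsKernelOf

section Homological

variable [Homological C]

/-- A subobject which contains the kernel of a morphism `b` and maps onto the codomain of `b` is
everything. -/
theorem isIso_of_kernel_factors {M W S : C} (m : M ⟶ W) [Mono m] (b : W ⟶ S)
    (hreg : IsRegularEpi (m ≫ b)) (h : ∃ l : kernel b ⟶ M, l ≫ m = kernel.ι b) : IsIso m := by
  -- The first projections of `pullback a a` and `pullback a b` are split epimorphisms onto `M` with
  -- the same kernel `kernel b`, so the Split Short Five Lemma makes `v` invertible. As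
  -- `pullback.snd a b` is a base change of `a`, the map `pullback.snd a a ≫ m` is then a regular
  -- epimorphism, hence so is `m`.
  obtain ⟨l, hl⟩ := h
  set a := m ≫ b with ha
  have hla : l ≫ a = 0 := by rw [ha, reassoc_of% hl, kernel.condition]
  let k : kernel b ⟶ pullback a a := pullback.lift 0 l (by simp [hla])
  let k' : kernel b ⟶ pullback a b := pullback.lift 0 (kernel.ι b) (by simp)
  have hml : Mono l := by
    have : Mono (l ≫ m) := by rw [hl]; infer_instance
    exact mono_of_mono l m
  have hk₁ : k ≫ pullback.fst a a = 0 := pullback.lift_fst _ _ _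
  have hk₂ : k ≫ pullback.snd a a = l := pullback.lift_snd _ _ _
  have hk₁' : k' ≫ pullback.fst a b = 0 := pullback.lift_fst _ _ _
  have hk₂' : k' ≫ pullback.snd a b = kernel.ι b := pullback.lift_snd _ _ _
  have hkk : IsKernelOf k (pullback.fst a a) := by
    refine ⟨?_, hk₁, fun T t ht => ?_⟩
    · have : Mono (k ≫ pullback.snd a a) := by rw [hk₂]; infer_instance
      exact mono_of_mono k (pullback.snd a a)
    · have h0 : (t ≫ pullback.snd a a ≫ m) ≫ b = 0 := by
        simp only [Category.assoc]
        rw [← ha, ← pullback.condition, reassoc_of% ht, zero_comp]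
      refine ⟨kernel.lift b _ h0, pullback.hom_ext ?_ ?_⟩
      · rw [Category.assoc, hk₁, comp_zero, ht]
      · rw [Category.assoc, hk₂, ← cancel_mono m, Category.assoc, hl, kernel.lift_ι,
          Category.assoc]
  have hkk' : IsKernelOf k' (pullback.fst a b) := by
    refine ⟨?_, hk₁', fun T t ht => ?_⟩
    · have : Mono (k' ≫ pullback.snd a b) := by rw [hk₂']; infer_instance
      exact mono_of_mono k' (pullback.snd a b)
    · have h0 : (t ≫ pullback.snd a b) ≫ b = 0 := by
        rw [Category.assoc, ← pullback.condition, reassoc_of% ht, zero_comp]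
      refine ⟨kernel.lift b _ h0, pullback.hom_ext ?_ ?_⟩
      · rw [Category.assoc, hk₁', comp_zero, ht]
      · rw [Category.assoc, hk₂', kernel.lift_ι]
  let v : pullback a a ⟶ pullback a b :=
    pullback.lift (pullback.fst a a) (pullback.snd a a ≫ m) (by
      rw [pullback.condition, Category.assoc])
  have hv₁ : v ≫ pullback.fst a b = pullback.fst a a := pullback.lift_fst _ _ _
  have hv₂ : v ≫ pullback.snd a b = pullback.snd a a ≫ m := pullback.lift_snd _ _ _
  obtain ⟨d, hd₁, hd₂⟩ := exists_pullback_lift a a (𝟙 M) (𝟙 M) rfl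
  obtain ⟨d', hd₁', hd₂'⟩ := exists_pullback_lift a b (𝟙 M) m (by simp [ha])
  have hv : IsIso v := by
    refine Homological.splitShortFive k (pullback.fst a a) d k'
      (pullback.fst a b) d' (𝟙 _) v (𝟙 M) hk₁ hk₁'
      hkk.nonempty_isLimit hkk'.nonempty_isLimit hd₁ hd₁'
      ?_ ?_ ?_ inferInstance inferInstance
    · apply pullback.hom_ext
      · rw [Category.assoc, hv₁, hk₁, Category.id_comp, hk₁']
      · rw [Category.assoc, hv₂, reassoc_of% hk₂, hl, Category.id_comp, hk₂']
    · rw [hv₁, Category.comp_id]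
    · apply pullback.hom_ext
      · simp [hv₁, hd₁, hd₁']
      · simp [hv₂, reassoc_of% hd₂, hd₂']
  have h1 : IsRegularEpi (pullback.snd a a ≫ m) := by
    rw [← hv₂]; infer_instance
  have := isRegularEpi_of_comp _ _ h1
  exact isIso_of_mono_of_strongEpi m

/-- A morphism over `S` which covers the kernel of its codomain, and whose domain covers `S`, is a
regular epimorphism. -/
theorem isRegularEpi_of_kernel_covered {X W S : C} (v : X ⟶ W) (b : W ⟶ S)
    (hreg : IsRegularEpi (v ≫ b)) {Z : C} (e : Z ⟶ kernel b) [StrongEpi e] (t : Z ⟶ X)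
    (h : t ≫ v = e ≫ kernel.ι b) : IsRegularEpi v := by
  obtain ⟨J, r, m, hr, hm, rfl⟩ := exists_regularEpi_mono_fac v
  have hmb : IsRegularEpi (m ≫ b) := by
    rw [Category.assoc] at hreg
    exact isRegularEpi_of_comp _ _ hreg
  have := isIso_of_kernel_factors m b hmb
    (exists_lift_of_strongEpi e m (t ≫ r) (kernel.ι b) (by rw [Category.assoc, h]))
  infer_instance

/-- A morphism with trivial kernel is a monomorphism. -/
theorem mono_of_kernel_trivial {X Y : C} (g : X ⟶ Y)
    (h : ∀ ⦃T : C⦄ (t : T ⟶ X), t ≫ g = 0 → t = 0) : Mono g := by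
  let d : X ⟶ pullback g g := pullback.lift (𝟙 X) (𝟙 X) rfl
  have hd₁ : d ≫ pullback.fst g g = 𝟙 X := pullback.lift_fst _ _ _
  have hd₂ : d ≫ pullback.snd g g = 𝟙 X := pullback.lift_snd _ _ _
  have hd : Mono d := by
    have : Mono (d ≫ pullback.fst g g) := by rw [hd₁]; infer_instance
    exact mono_of_mono d (pullback.fst g g)
  have h0 : kernel.ι (pullback.fst g g) = 0 := by
    apply pullback.hom_ext
    · rw [kernel.condition, zero_comp]
    · rw [zero_comp]
      apply h
      rw [Category.assoc, ← pullback.condition, kernel.condition_assoc, zero_comp]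
  have : IsIso d := isIso_of_kernel_factors d (pullback.fst g g) (by rw [hd₁]; infer_instance)
    ⟨0, by rw [h0, zero_comp]⟩
  have h12 : pullback.fst g g = pullback.snd g g := by
    rw [← cancel_epi d, hd₁, hd₂]
  refine ⟨fun a b hab => ?_⟩
  have h1 : pullback.lift a b hab ≫ pullback.fst g g = a := pullback.lift_fst _ _ _
  have h2 : pullback.lift a b hab ≫ pullback.snd g g = b := pullback.lift_snd _ _ _
  rw [← h1, h12, h2]

/-- A regular epimorphism is a cokernel of its kernel. -/
theorem exists_desc_of_kernel {K A B : C} {k : K ⟶ A} {f : A ⟶ B} (hk : IsKernelOf k f)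
    [hf : IsRegularEpi f] {Z : C} (g : A ⟶ Z) (hg : k ≫ g = 0) : ∃ l : B ⟶ Z, f ≫ l = g := by
  have hc := regularEpi_desc_condition f k hk.w hk.nonempty_isLimit.some g hg
  refine ⟨IsRegularEpi.desc f g ?_, IsRegularEpi.fac f g _⟩
  obtain ⟨l, h1, h2⟩ := exists_pullback_lift f f _ _ (IsRegularEpi.w f)
  rw [← h1, ← h2, Category.assoc, hc, Category.assoc]

/-- A morphism which annihilates every element annihilated by a regular epimorphism `f` factors
through `f`. -/
theorem exists_desc_of_forall {A B : C} (f : A ⟶ B) [IsRegularEpi f] {Z : C} (g : A ⟶ Z)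
    (hg : ∀ ⦃T : C⦄ (t : T ⟶ A), t ≫ f = 0 → t ≫ g = 0) : ∃ l : B ⟶ Z, f ≫ l = g :=
  exists_desc_of_kernel (IsKernelOf.kernel_ι f) g (hg _ (kernel.condition f))

/-- The second factor of a morphism with regular epic first factor is a monomorphism if the
composite and the first factor have the same kernel. -/
theorem mono_of_regularEpi_comp {A B Z : C} (f : A ⟶ B) [IsRegularEpi f] (g : B ⟶ Z)
    (h : ∀ ⦃T : C⦄ (t : T ⟶ A), t ≫ f ≫ g = 0 → t ≫ f = 0) : Mono g := by
  refine mono_of_kernel_trivial g fun T t ht => ?_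
  have h1 : (pullback.snd t f) ≫ f ≫ g = 0 := by
    rw [← pullback.condition_assoc, ht, comp_zero]
  rw [← cancel_epi (pullback.fst t f), pullback.condition, h _ h1, comp_zero]

/-- The quotient by a normal subobject, as a regular epimorphism of which it is the kernel. -/
theorem exists_quotient_of_isNormalMono {N A : C} (k : N ⟶ A) (h : IsNormalMono k) :
    ∃ (Q : C) (q : A ⟶ Q), IsRegularEpi q ∧ IsKernelOf k q := by
  obtain ⟨n⟩ := h.normalMono
  obtain ⟨J, e, m, he, hm, hem⟩ := exists_regularEpi_mono_fac n.g
  have hn := IsKernelOf.of_isLimit n.isLimit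
  refine ⟨J, e, he, hn.mono, ?_, fun T t ht => hn.lift t ?_⟩
  · rw [← cancel_mono m, Category.assoc, hem, zero_comp, n.w]
  · rw [← hem, reassoc_of% ht, zero_comp]

/-- A regular epimorphism with kernel `k` exhibits its codomain as the cokernel of `k`. -/
theorem nonempty_iso_cokernel {N A Q : C} {k : N ⟶ A} {q : A ⟶ Q} (hq : IsRegularEpi q)
    (hk : IsKernelOf k q) [HasCokernel k] : Nonempty (Q ≅ cokernel k) := by
  obtain ⟨l, hl⟩ := exists_desc_of_kernel hk (cokernel.π k) (cokernel.condition k)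
  refine ⟨⟨l, cokernel.desc k q hk.w, ?_, ?_⟩⟩
  · rw [← cancel_epi q, reassoc_of% hl, cokernel.π_desc, Category.comp_id]
  · rw [← cancel_epi (cokernel.π k), cokernel.π_desc_assoc, hl, Category.comp_id]

/-- A reflexive relation is Euclidean. -/
theorem exists_euclidean {R X : C} (r₁ r₂ : R ⟶ X) (hj : JointlyMono₂ r₁ r₂) (s : X ⟶ R)
    (hs₁ : s ≫ r₁ = 𝟙 X) (hs₂ : s ≫ r₂ = 𝟙 X) {T : C} (a b : T ⟶ R) (hab : a ≫ r₁ = b ≫ r₁) :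
    ∃ c : T ⟶ R, c ≫ r₁ = a ≫ r₂ ∧ c ≫ r₂ = b ≫ r₂ := by
  obtain ⟨ρ, hρ₁, hρ₂⟩ := exists_prod_lift r₁ r₂
  have hmr : Mono ρ := ⟨fun x y hxy => hj.right_cancellation _ _
    (by rw [← hρ₁, reassoc_of% hxy]) (by rw [← hρ₂, reassoc_of% hxy])⟩
  obtain ⟨σ, hσ₁, hσ₂⟩ :=
    exists_prod_lift (pullback.fst r₁ r₁ ≫ r₂) (pullback.snd r₁ r₁ ≫ r₂)
  -- In elements, this subobject consists of the pairs `x R y`, `x R z` with `y R z`. It contains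
  -- the diagonal by reflexivity and the kernel of the first projection, where `x = y = 0` and `0 R
  -- z` is given; hence it is everything.
  let m := pullback.fst σ ρ
  have hiso : IsIso m := by
    refine isIso_of_kernel_factors m (pullback.fst r₁ r₁) ?_ ?_
    · obtain ⟨d, hd₁, hd₂⟩ := exists_pullback_lift r₁ r₁ (𝟙 R) (𝟙 R) rfl
      obtain ⟨d', hd₁', -⟩ := exists_pullback_lift σ ρ d (r₂ ≫ s) (by
        apply Limits.prod.hom_ext
        · simp [hσ₁, hρ₁, hs₁, reassoc_of% hd₁]
        · simp [hσ₂, hρ₂, hs₂, reassoc_of% hd₂])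
      exact isRegularEpi_of_section _ d' (by rw [reassoc_of% hd₁', hd₁])
    · obtain ⟨l, hl, -⟩ := exists_pullback_lift σ ρ (kernel.ι (pullback.fst r₁ r₁))
        (kernel.ι _ ≫ pullback.snd r₁ r₁) (by
          apply Limits.prod.hom_ext
          · rw [Category.assoc, Category.assoc, hσ₁, hρ₁, Category.assoc, ← pullback.condition,
              kernel.condition_assoc, kernel.condition_assoc, zero_comp, zero_comp]
          · simp [hσ₂, hρ₂])
      exact ⟨l, hl⟩
  obtain ⟨y, hy₁, hy₂⟩ := exists_pullback_lift r₁ r₁ a b hab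
  obtain ⟨z, hz⟩ : ∃ z : T ⟶ R, z ≫ ρ = y ≫ σ := ⟨y ≫ inv m ≫ pullback.snd σ ρ, by
    rw [Category.assoc, Category.assoc, ← pullback.condition, IsIso.inv_hom_id_assoc]⟩
  refine ⟨z, ?_, ?_⟩
  · calc z ≫ r₁ = (z ≫ ρ) ≫ prod.fst := by rw [Category.assoc, hρ₁]
      _ = a ≫ r₂ := by rw [hz, Category.assoc, hσ₁, reassoc_of% hy₁]
  · calc z ≫ r₂ = (z ≫ ρ) ≫ prod.snd := by rw [Category.assoc, hρ₂]
      _ = b ≫ r₂ := by rw [hz, Category.assoc, hσ₂, reassoc_of% hy₂]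

/-- The Mal'tsev property: a reflexive relation is an equivalence relation. -/
theorem isEquivalenceRelation_of_reflexive {R X : C} (r₁ r₂ : R ⟶ X) (hj : JointlyMono₂ r₁ r₂)
    (s : X ⟶ R) (hs₁ : s ≫ r₁ = 𝟙 X) (hs₂ : s ≫ r₂ = 𝟙 X) : IsEquivalenceRelation r₁ r₂ := by
  have eucl := fun {T : C} (a b : T ⟶ R) => exists_euclidean r₁ r₂ hj s hs₁ hs₂ a b
  -- Symmetry is the Euclidean property for `x R y` and `x R x`; transitivity is the same property
  -- for `y R x` and `y R z`.
  obtain ⟨σ, hσ₁, hσ₂⟩ := eucl (𝟙 R) (r₁ ≫ s) (by simp [hs₁])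
  simp only [Category.id_comp, Category.assoc, hs₂, Category.comp_id] at hσ₁ hσ₂
  obtain ⟨τ, hτ₁, hτ₂⟩ := eucl (pullback.fst r₂ r₁ ≫ σ) (pullback.snd r₂ r₁)
    (by rw [Category.assoc, hσ₁, pullback.condition])
  rw [Category.assoc, hσ₂] at hτ₁
  exact ⟨⟨{ right_cancellation := hj.right_cancellation
            r := s, reflexivity₁ := hs₁, reflexivity₂ := hs₂
            s := σ, symmetry₁ := hσ₁, symmetry₂ := hσ₂
            c := _, isLimit := pullback.isLimit r₂ r₁
            t := τ, transitivity₁ := hτ₁, transitivity₂ := hτ₂ }⟩⟩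

end Homological

end Toolkit

/-! ### Lifting kernels along regular epimorphisms; images of normal subobjects. -/

section Covers

variable {C : Type u₁} [Category.{v₁} C] [HasZeroMorphisms C]

/-- For a morphism of split epimorphisms with regular epic top component, the induced morphism of
kernels is a regular epimorphism: every element of the target kernel is covered. -/
theorem exists_kernel_cover [Homological C] {R X S Y : C} (r : R ⟶ X) (σ : X ⟶ R)
    (hσ : σ ≫ r = 𝟙 X) (r' : S ⟶ Y) (σ' : Y ⟶ S) (ρ : R ⟶ S) [hρ : IsRegularEpi ρ] (g : X ⟶ Y)
    (h₁ : ρ ≫ r' = r ≫ g) (h₂ : σ ≫ ρ = g ≫ σ') {T : C} (t : T ⟶ S) (ht : t ≫ r' = 0) :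
    ∃ (T' : C) (e : T' ⟶ T) (l : T' ⟶ R), IsRegularEpi e ∧ l ≫ r = 0 ∧ l ≫ ρ = e ≫ t := by
  obtain ⟨c, hc₁, hc₂⟩ := exists_pullback_lift g r' r ρ h₁.symm
  -- The kernel of `pullback.snd g r'` consists of the pairs `(x, 0)` with `g x = 0`, and `σ x` is a
  -- preimage of such a pair because `σ` and `σ'` are compatible.
  have hc : IsRegularEpi c := by
    refine isRegularEpi_of_kernel_covered c (pullback.snd g r') (by rwa [hc₂])
      (𝟙 (kernel (pullback.snd g r'))) (kernel.ι _ ≫ pullback.fst g r' ≫ σ) ?_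
    apply pullback.hom_ext
    · simp [hc₁, hσ]
    · simp only [Category.assoc, hc₂, h₂, Category.id_comp]
      rw [pullback.condition_assoc, kernel.condition_assoc, kernel.condition, zero_comp]
  obtain ⟨y, hy₁, hy₂⟩ := exists_pullback_lift g r' (0 : T ⟶ X) t (by simp [ht])
  refine ⟨pullback y c, pullback.fst y c, pullback.snd y c, inferInstance, ?_, ?_⟩
  · rw [← hc₁, ← pullback.condition_assoc, hy₁, comp_zero]
  · rw [← hc₂, ← pullback.condition_assoc, hy₂]

/-- The image of a normal subobject along a regular epimorphism is normal. -/
theorem isNormalMono_image [SemiAbelian C] {N X Y M : C} (k : N ⟶ X) (hk : IsNormalMono k)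
    (g : X ⟶ Y) [IsRegularEpi g] (e : N ⟶ M) [IsRegularEpi e] (m : M ⟶ Y) [Mono m]
    (hem : e ≫ m = k ≫ g) : IsNormalMono m := by
  -- The image in `Y ⨯ Y` of the kernel pair of `h` is a reflexive relation, hence a kernel pair by
  -- the Mal'tsev property and exactness. Its class of zero is the image of `N`.
  obtain ⟨Z, h, hh, hkh⟩ := exists_quotient_of_isNormalMono k hk
  obtain ⟨p, hp₁, hp₂⟩ := exists_prod_lift (pullback.fst h h ≫ g) (pullback.snd h h ≫ g)
  obtain ⟨S, ρ, s, hρ, hs, hρs⟩ := exists_regularEpi_mono_fac p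
  obtain ⟨d, hd₁, hd₂⟩ := exists_pullback_lift h h (𝟙 X) (𝟙 X) rfl
  obtain ⟨δ, hδ₁, hδ₂⟩ := exists_prod_lift (𝟙 Y) (𝟙 Y)
  obtain ⟨σ, hσ⟩ := exists_lift_of_strongEpi g s (d ≫ ρ) δ (by
    apply Limits.prod.hom_ext
    · simp [hρs, hp₁, hδ₁, reassoc_of% hd₁]
    · simp [hρs, hp₂, hδ₂, reassoc_of% hd₂])
  have hj : JointlyMono₂ (s ≫ prod.fst) (s ≫ prod.snd) := ⟨fun T a b h₁ h₂ => by
    rw [← cancel_mono s]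
    apply Limits.prod.hom_ext
    · simpa using h₁
    · simpa using h₂⟩
  have hρ₁ : ρ ≫ s ≫ prod.fst = pullback.fst h h ≫ g := by rw [reassoc_of% hρs, hp₁]
  have hρ₂ : ρ ≫ s ≫ prod.snd = pullback.snd h h ≫ g := by rw [reassoc_of% hρs, hp₂]
  have hσ₁ : σ ≫ s ≫ prod.fst = 𝟙 Y := by rw [reassoc_of% hσ, hδ₁]
  have hσ₂ : σ ≫ s ≫ prod.snd = 𝟙 Y := by rw [reassoc_of% hσ, hδ₂]
  obtain ⟨E⟩ := (SemiAbelian.effective _ _ (isEquivalenceRelation_of_reflexive _ _ hj σ hσ₁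
    hσ₂)).nonempty_effectiveEquivalenceRelation
  have hkp := E.isKernelPair
  have hdσ : d ≫ ρ = g ≫ σ := by
    apply hj.right_cancellation
    · simp only [Category.assoc, hρ₁, hσ₁, reassoc_of% hd₁, Category.comp_id]
    · simp only [Category.assoc, hρ₂, hσ₂, reassoc_of% hd₂, Category.comp_id]
  refine IsKernelOf.isNormalMono (f := E.π) ⟨inferInstance, ?_, fun T t ht => ?_⟩
  · obtain ⟨j, hj₁, hj₂⟩ := exists_pullback_lift h h 0 k (by simp [hkh.w])
    rw [← cancel_epi e, reassoc_of% hem, ← hj₂, Category.assoc, ← reassoc_of% hρ₂]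
    have := hkp.w
    simp only [Category.assoc] at this
    rw [← this, reassoc_of% hρ₁, reassoc_of% hj₁, zero_comp, comp_zero]
  · obtain ⟨t', ht₁', ht₂'⟩ := hkp.exists_lift (0 : T ⟶ Y) t (by rw [zero_comp, ht])
    obtain ⟨T', c, l, hc, hl₁, hl₂⟩ := exists_kernel_cover (pullback.fst h h) d hd₁
      (s ≫ prod.fst) σ ρ g hρ₁ hdσ t' ht₁'
    obtain ⟨n, hn⟩ := hkh.lift (l ≫ pullback.snd h h) (by
      rw [Category.assoc, ← pullback.condition, reassoc_of% hl₁, zero_comp])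
    refine exists_lift_of_strongEpi c m (n ≫ e) t ?_
    rw [Category.assoc, hem, reassoc_of% hn, ← hρ₂, reassoc_of% hl₂, ht₂']

end Covers

/-! ### Regular epi-reflective and Birkhoff subcategories. -/

section Reflections

variable {C : Type u₁} [Category.{v₁} C] {D : Type u₂} [Category.{v₂} D]
variable {L : C ⥤ D} {R : D ⥤ C} (adj : L ⊣ R)

/-- A morphism into the reflective subcategory factors through the unit. -/
theorem exists_unitAt_fac {X : C} {V : D} (x : X ⟶ R.obj V) :
    ∃ v : L.obj X ⟶ V, unitAt adj X ≫ R.map v = x :=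
  ⟨(adj.homEquiv _ _).symm x, by
    simp [unitAt, Adjunction.homEquiv_counit]⟩

theorem unitAt_comp_map_injective {X : C} {V : D} {x y : L.obj X ⟶ V}
    (h : unitAt adj X ≫ R.map x = unitAt adj X ≫ R.map y) : x = y :=
  (adj.homEquiv _ _).injective (by
    rw [Adjunction.homEquiv_unit, Adjunction.homEquiv_unit]
    exact h)

theorem exists_unitAt_fac_of_essImage {X Y : C} (hY : R.essImage Y) (x : X ⟶ Y) :
    ∃ v : R.obj (L.obj X) ⟶ Y, unitAt adj X ≫ v = x := by
  obtain ⟨V, ⟨i⟩⟩ := hY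
  obtain ⟨v, hv⟩ := exists_unitAt_fac adj (x ≫ i.inv)
  exact ⟨R.map v ≫ i.hom, by rw [reassoc_of% hv, i.inv_hom_id, Category.comp_id]⟩

/-- A regular epi-reflective subcategory is closed under subobjects. -/
theorem essImage_of_mono [R.Full] [R.Faithful] (h : IsRegularEpiReflective adj) {X Y : C}
    (m : X ⟶ Y) [Mono m] (hY : R.essImage Y) : R.essImage X := by
  obtain ⟨v, hv⟩ := exists_unitAt_fac_of_essImage adj hY m
  have := h.regularEpi_unit X
  have : Mono (unitAt adj X ≫ v) := by rw [hv]; infer_instance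
  have := mono_of_mono (unitAt adj X) v
  have := isIso_of_mono_of_strongEpi (unitAt adj X)
  exact ⟨_, ⟨(asIso (unitAt adj X)).symm⟩⟩

variable [HasZeroMorphisms C]

theorem comp_eq_zero_of_comp_unitAt {X Y T : C} (hY : R.essImage Y) (x : X ⟶ Y) (t : T ⟶ X)
    (ht : t ≫ unitAt adj X = 0) : t ≫ x = 0 := by
  obtain ⟨v, hv⟩ := exists_unitAt_fac_of_essImage adj hY x
  rw [← hv, reassoc_of% ht, zero_comp]

theorem comp_unitAt_eq_zero {X Y T : C} (t : T ⟶ X) (x : X ⟶ Y)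
    (ht : t ≫ unitAt adj X = 0) : (t ≫ x) ≫ unitAt adj Y = 0 := by
  rw [Category.assoc, ← unitAt_naturality, reassoc_of% ht, zero_comp]

/-- For a split epimorphism `a`, the morphism `K[a] ⟶ K[R L a]` is a regular epimorphism. -/
theorem exists_kernel_cover_unitAt [Homological C] [R.Full] [R.Faithful]
    (h : IsRegularEpiReflective adj) {X Y : C} (a : X ⟶ Y) (s : Y ⟶ X) (hs : s ≫ a = 𝟙 Y) {T : C}
    (t : T ⟶ R.obj (L.obj X)) (ht : t ≫ R.map (L.map a) = 0) :
    ∃ (T' : C) (e : T' ⟶ T) (l : T' ⟶ X), IsRegularEpi e ∧ l ≫ a = 0 ∧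
      l ≫ unitAt adj X = e ≫ t :=
  have := h.regularEpi_unit X
  exists_kernel_cover a s hs (R.map (L.map a)) (R.map (L.map s)) (unitAt adj X) (unitAt adj Y)
    (unitAt_naturality adj a) (unitAt_naturality adj s).symm t ht

/-- For a Birkhoff subcategory, a regular epimorphism restricts to a regular epimorphism between
the kernels of the units. -/
theorem exists_unitKernel_cover [SemiAbelian C] [R.Full] [R.Faithful] (h : IsBirkhoff adj)
    {X Y : C} (g : X ⟶ Y) [hg : IsRegularEpi g] {T : C} (t : T ⟶ Y) (ht : t ≫ unitAt adj Y = 0) :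
    ∃ (T' : C) (e : T' ⟶ T) (l : T' ⟶ X), IsRegularEpi e ∧ l ≫ unitAt adj X = 0 ∧
      l ≫ g = e ≫ t := by
  have := h.regularEpi_unit X
  obtain ⟨M, r, m, hr, hm, hrm⟩ := exists_regularEpi_mono_fac (kernel.ι (unitAt adj X) ≫ g)
  -- The quotient of `Y` by the image `M` of `K[η_X]` is also a regular quotient of the reflection
  -- of `X`, so it lies in the Birkhoff subcategory. Hence `q` kills `K[η_Y]`, which is therefore
  -- contained in `M`.
  have hnorm := isNormalMono_image _ (IsKernelOf.kernel_ι (unitAt adj X)).isNormalMono g r m hrm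
  obtain ⟨Q, q, hq, hmq⟩ := exists_quotient_of_isNormalMono m hnorm
  obtain ⟨w, hw⟩ := exists_desc_of_kernel (IsKernelOf.kernel_ι (unitAt adj X)) (g ≫ q)
    (by rw [← reassoc_of% hrm, hmq.w, comp_zero])
  have hwreg : IsRegularEpi w := isRegularEpi_of_comp _ _ (by rw [hw]; exact isRegularEpi_comp _ _)
  have hQ : R.essImage Q := h.quotient_closed w hwreg (R.obj_mem_essImage _)
  obtain ⟨l, hl⟩ := hmq.lift t (comp_eq_zero_of_comp_unitAt adj hQ q t ht)
  refine ⟨pullback l r, pullback.fst l r, pullback.snd l r ≫ kernel.ι _, inferInstance, ?_, ?_⟩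
  · rw [Category.assoc, kernel.condition, comp_zero]
  · rw [Category.assoc, ← hrm, ← pullback.condition_assoc, hl]

end Reflections

/-! ### Regular epimorphisms in a semi-abelian category are monadic extensions. -/

section Monadicity

variable {C : Type u₁} [Category.{v₁} C]

/-- A reflexive pair in a semi-abelian category has a coequalizer, whose kernel pair is covered by
the pair. -/
theorem exists_reflexive_coequalizer [HasZeroMorphisms C] [SemiAbelian C] {X Y : C} (f g : X ⟶ Y)
    (s : Y ⟶ X) (hf : s ≫ f = 𝟙 Y) (hg : s ≫ g = 𝟙 Y) :
    ∃ (Q : C) (q : Y ⟶ Q), IsRegularEpi q ∧ f ≫ q = g ≫ q ∧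
      ∀ ⦃T : C⦄ (a b : T ⟶ Y), a ≫ q = b ≫ q →
        ∃ (T' : C) (e : T' ⟶ T) (l : T' ⟶ X), IsRegularEpi e ∧ l ≫ f = e ≫ a ∧ l ≫ g = e ≫ b := by
  obtain ⟨p, hp₁, hp₂⟩ := exists_prod_lift f g
  obtain ⟨S, ρ, m, hρ, hm, hρm⟩ := exists_regularEpi_mono_fac p
  have hj : JointlyMono₂ (m ≫ prod.fst) (m ≫ prod.snd) := ⟨fun T a b h₁ h₂ => by
    rw [← cancel_mono m]
    apply Limits.prod.hom_ext
    · simpa using h₁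
    · simpa using h₂⟩
  have hρ₁ : ρ ≫ m ≫ prod.fst = f := by rw [reassoc_of% hρm, hp₁]
  have hρ₂ : ρ ≫ m ≫ prod.snd = g := by rw [reassoc_of% hρm, hp₂]
  obtain ⟨E⟩ := (SemiAbelian.effective _ _ (isEquivalenceRelation_of_reflexive _ _ hj (s ≫ ρ)
    (by rw [Category.assoc, hρ₁, hf]) (by rw [Category.assoc, hρ₂,
      hg]))).nonempty_effectiveEquivalenceRelation
  have hkp := E.isKernelPair
  refine ⟨E.B, E.π, inferInstance, ?_, fun T a b hab => ?_⟩
  · calc f ≫ E.π = ρ ≫ (m ≫ prod.fst) ≫ E.π := by rw [← Category.assoc, hρ₁]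
      _ = g ≫ E.π := by rw [hkp.w, ← Category.assoc, hρ₂]
  · obtain ⟨t, ht₁, ht₂⟩ := hkp.exists_lift a b hab
    refine ⟨pullback t ρ, pullback.fst t ρ, pullback.snd t ρ, inferInstance, ?_, ?_⟩
    · rw [← hρ₁, ← pullback.condition_assoc, ht₁]
    · rw [← hρ₂, ← pullback.condition_assoc, ht₂]

/-- A regular epimorphism over `B` whose kernel pair is covered by a parallel pair is a coequalizer
of that pair in the category of extensions of `B`. -/
theorem nonempty_isColimit_over {B : C} {X Y Q : (MorphismProperty.regularEpi C).Over ⊤ B}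
    (f g : X ⟶ Y) (q : Y ⟶ Q) (w : f ≫ q = g ≫ q) (hq : IsRegularEpi q.left)
    (hcov : ∀ ⦃T : C⦄ (a b : T ⟶ Y.left), a ≫ q.left = b ≫ q.left →
      ∃ (T' : C) (e : T' ⟶ T) (l : T' ⟶ X.left), IsRegularEpi e ∧
        l ≫ f.left = e ≫ a ∧ l ≫ g.left = e ≫ b) :
    Nonempty (IsColimit (Cofork.ofπ q w)) := by
  have key : ∀ {Z : (MorphismProperty.regularEpi C).Over ⊤ B} (k : Y ⟶ Z), f ≫ k = g ≫ k →
      ∃ u : Q ⟶ Z, q ≫ u = k := by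
    intro Z k hk
    have hk' : f.left ≫ k.left = g.left ≫ k.left := congrArg (fun t => t.left) hk
    obtain ⟨T', e, l, he, hl₁, hl₂⟩ := hcov _ _ (IsRegularEpi.w q.left)
    obtain ⟨u, hfac⟩ : ∃ u, q.left ≫ u = k.left := ⟨_, IsRegularEpi.fac q.left k.left (by
      rw [← cancel_epi e, ← reassoc_of% hl₁, hk', reassoc_of% hl₂])⟩
    refine ⟨MorphismProperty.Over.homMk u ?_ trivial, ?_⟩
    · rw [← cancel_epi q.left, reassoc_of% hfac, MorphismProperty.Over.w, MorphismProperty.Over.w]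
    · ext
      exact hfac
  have hepi : Epi q := ⟨fun a b hab => by
    ext
    rw [← cancel_epi q.left]
    exact congrArg (fun t => t.left) hab⟩
  exact ⟨Cofork.IsColimit.mk' _ fun s => ⟨(key s.π s.condition).choose,
    (key s.π s.condition).choose_spec, fun {m} hm => by
      rw [← cancel_epi q]
      exact Eq.trans hm (key s.π s.condition).choose_spec.symm⟩⟩

instance [Regular C] : (MorphismProperty.regularEpi C).IsStableUnderComposition where
  comp_mem f g hf hg := by
    have : IsRegularEpi f := hf
    have : IsRegularEpi g := hg
    exact isRegularEpi_comp f g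

section PullbackMap

variable {E B : C} (p : E ⟶ B)

/-- Pulling back along a regular epimorphism reflects isomorphisms. -/
theorem isIso_of_isIso_pullback [HasZeroMorphisms C] [Homological C] [IsRegularEpi p] {X Y : C}
    {x : X ⟶ B} {y : Y ⟶ B} {g : X ⟶ Y} (hg : g ≫ y = x) (γ : pullback x p ⟶ pullback y p)
    (h₁ : γ ≫ pullback.fst y p = pullback.fst x p ≫ g)
    (h₂ : γ ≫ pullback.snd y p = pullback.snd x p) (hγ : IsIso γ) : IsIso g := by
  have hreg : IsRegularEpi g := by
    refine isRegularEpi_of_comp (pullback.fst x p) _ ?_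
    rw [← h₁]
    infer_instance
  have hmono : Mono g := mono_of_kernel_trivial _ fun T t ht => by
    obtain ⟨l, hl₁, hl₂⟩ := exists_pullback_lift x p t 0 (by
      rw [← hg, reassoc_of% ht, zero_comp, zero_comp])
    have h0 : l ≫ γ = 0 := by
      apply pullback.hom_ext
      · rw [Category.assoc, h₁, reassoc_of% hl₁, ht, zero_comp]
      · rw [Category.assoc, h₂, hl₂, zero_comp]
    have hl : l = 0 := by rw [← cancel_mono γ, h0, zero_comp]
    rw [← hl₁, hl, zero_comp]
  exact isIso_of_mono_of_strongEpi g

variable [Regular C] {X Y Q : C} {x : X ⟶ B} {y : Y ⟶ B} {z : Q ⟶ B} {q : Y ⟶ Q}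

/-- By pasting of pullbacks, `κ` is a base change of `q`. This serves both the monadicity criterion
and the descent of normality along a quotient map. -/
theorem isRegularEpi_pullback_map (hq : q ≫ z = y) (κ : pullback y p ⟶ pullback z p)
    (h₁ : κ ≫ pullback.fst z p = pullback.fst y p ≫ q)
    (h₂ : κ ≫ pullback.snd z p = pullback.snd y p) (hreg : IsRegularEpi q) : IsRegularEpi κ := by
  refine isRegularEpi_of_isPullback (h := pullback.fst z p) (i := q) (g := pullback.fst y p)
    (IsPullback.of_right ?_ h₁ (IsPullback.of_hasPullback z p).flip) hreg
  rw [h₂, hq]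
  exact (IsPullback.of_hasPullback y p).flip

/-- If the kernel pair of `q` is covered by a parallel pair, then so is its pullback along `p`. -/
theorem exists_cover_pullback {f g : X ⟶ Y} (hf : f ≫ y = x)
    (hcov : ∀ ⦃T : C⦄ (a b : T ⟶ Y), a ≫ q = b ≫ q →
      ∃ (T' : C) (e : T' ⟶ T) (l : T' ⟶ X), IsRegularEpi e ∧ l ≫ f = e ≫ a ∧ l ≫ g = e ≫ b)
    (φ : pullback x p ⟶ pullback y p) (hφ₁ : φ ≫ pullback.fst y p = pullback.fst x p ≫ f)
    (hφ₂ : φ ≫ pullback.snd y p = pullback.snd x p)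
    (γ : pullback x p ⟶ pullback y p) (hγ₁ : γ ≫ pullback.fst y p = pullback.fst x p ≫ g)
    (hγ₂ : γ ≫ pullback.snd y p = pullback.snd x p)
    (κ : pullback y p ⟶ pullback z p) (hκ₁ : κ ≫ pullback.fst z p = pullback.fst y p ≫ q)
    (hκ₂ : κ ≫ pullback.snd z p = pullback.snd y p) {T : C} (a b : T ⟶ pullback y p)
    (hab : a ≫ κ = b ≫ κ) :
    ∃ (T' : C) (e : T' ⟶ T) (l : T' ⟶ pullback x p), IsRegularEpi e ∧
      l ≫ φ = e ≫ a ∧ l ≫ γ = e ≫ b := by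
  obtain ⟨T', e, l, he, hl₁, hl₂⟩ := hcov (a ≫ pullback.fst y p) (b ≫ pullback.fst y p) (by
    rw [Category.assoc, Category.assoc, ← hκ₁, reassoc_of% hab])
  have hab₂ : a ≫ pullback.snd y p = b ≫ pullback.snd y p := by
    rw [← hκ₂, reassoc_of% hab]
  obtain ⟨m, hm₁, hm₂⟩ := exists_pullback_lift x p l (e ≫ a ≫ pullback.snd y p) (by
    rw [← hf, reassoc_of% hl₁, Category.assoc, Category.assoc, pullback.condition])
  refine ⟨T', e, m, he, pullback.hom_ext ?_ ?_, pullback.hom_ext ?_ ?_⟩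
  · rw [Category.assoc, hφ₁, reassoc_of% hm₁, hl₁, Category.assoc]
  · rw [Category.assoc, hφ₂, hm₂, Category.assoc]
  · rw [Category.assoc, hγ₁, reassoc_of% hm₁, hl₂, Category.assoc]
  · rw [Category.assoc, hγ₂, hm₂, hab₂, Category.assoc]

end PullbackMap

/-- Every extension in a semi-abelian category is a monadic extension. -/
theorem isMonadicExtension_of_isRegularEpi [HasZeroMorphisms C] [SemiAbelian C] {E B : C}
    (p : E ⟶ B) (hp : IsRegularEpi p) : IsMonadicExtension p := by
  refine ⟨hp, ?_⟩
  -- The reflexive form of Beck's theorem applies, with composition with `p` as left adjoint.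
  -- Coequalizers of reflexive pairs are preserved because they are recognised by two properties
  -- stable under base change: being a regular epimorphism, and having a kernel pair covered by the
  -- given pair.
  let G := MorphismProperty.Over.pullback (MorphismProperty.regularEpi C) ⊤ p
  have hG₁ : ∀ {X Y : (MorphismProperty.regularEpi C).Over ⊤ B} (g : X ⟶ Y),
      (G.map g).left ≫ pullback.fst Y.hom p = pullback.fst X.hom p ≫ g.left :=
    fun g => pullback.lift_fst _ _ _
  have hG₂ : ∀ {X Y : (MorphismProperty.regularEpi C).Over ⊤ B} (g : X ⟶ Y),
      (G.map g).left ≫ pullback.snd Y.hom p = pullback.snd X.hom p :=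
    fun g => pullback.lift_snd _ _ _
  have hrefl : G.ReflectsIsomorphisms := ⟨fun {X Y} g hg => by
    have hiso : IsIso (G.map g).left :=
      (MorphismProperty.Over.forget _ _ _ ⋙ CategoryTheory.Over.forget _).map_isIso (G.map g)
    have := isIso_of_isIso_pullback p (MorphismProperty.Over.w g) (G.map g).left (hG₁ g) (hG₂ g)
      hiso
    have hg' : g = (MorphismProperty.Over.isoMk (asIso g.left) (MorphismProperty.Over.w g)).hom := by
      ext
      rfl
    rw [hg']
    infer_instance⟩
  have hcoeq : ∀ {X Y : (MorphismProperty.regularEpi C).Over ⊤ B} (f g : X ⟶ Y)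
      [IsReflexivePair f g], ∃ (Q : (MorphismProperty.regularEpi C).Over ⊤ B) (q : Y ⟶ Q)
      (w : f ≫ q = g ≫ q), Nonempty (IsColimit (Cofork.ofπ q w)) ∧
      Nonempty (IsColimit (Cofork.ofπ (G.map q) (by rw [← G.map_comp, w, G.map_comp]) :
        Cofork (G.map f) (G.map g))) := by
    intro X Y f g _
    obtain ⟨Q, q, hq, hfgq, hcov⟩ := exists_reflexive_coequalizer f.left g.left
      (commonSection f g).left (congrArg (fun t => t.left) (section_comp_left f g))
      (congrArg (fun t => t.left) (section_comp_right f g))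
    obtain ⟨T', e, l, he, hl₁, hl₂⟩ := hcov _ _ (IsRegularEpi.w q)
    obtain ⟨u, hu⟩ : ∃ u, q ≫ u = Y.hom := ⟨_, IsRegularEpi.fac q Y.hom (by
      rw [← cancel_epi e, ← reassoc_of% hl₁, MorphismProperty.Over.w, ← reassoc_of% hl₂,
        MorphismProperty.Over.w])⟩
    have hureg : IsRegularEpi u := by
      refine isRegularEpi_of_comp q u ?_
      rw [hu]
      exact Y.prop
    let Q' : (MorphismProperty.regularEpi C).Over ⊤ B := MorphismProperty.Over.mk ⊤ u hureg
    let q' : Y ⟶ Q' := MorphismProperty.Over.homMk q hu trivial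
    have w : f ≫ q' = g ≫ q' := by
      ext
      exact hfgq
    refine ⟨Q', q', w, nonempty_isColimit_over f g q' w hq hcov,
      nonempty_isColimit_over _ _ _ _ ?_ ?_⟩
    · exact isRegularEpi_pullback_map p hu (G.map q').left (hG₁ q') (hG₂ q') hq
    · intro T a b hab
      exact exists_cover_pullback p (MorphismProperty.Over.w f) hcov (G.map f).left (hG₁ f)
        (hG₂ f) (G.map g).left (hG₁ g) (hG₂ g) (G.map q').left (hG₁ q') (hG₂ q') a b hab
  have : HasReflexiveCoequalizers ((MorphismProperty.regularEpi C).Over ⊤ B) := ⟨fun _ _ f g _ => by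
    obtain ⟨Q, q, w, ⟨h⟩, -⟩ := hcoeq f g
    exact HasColimit.mk ⟨_, h⟩⟩
  have : Monad.PreservesColimitOfIsReflexivePair G := ⟨fun _ _ f g _ => by
    obtain ⟨Q, q, w, ⟨h⟩, ⟨h'⟩⟩ := hcoeq f g
    exact preservesColimit_of_preserves_colimit_cocone h
      ((isColimitMapCoconeCoforkEquiv G w).symm h')⟩
  exact ⟨Monad.monadicOfHasPreservesReflexiveCoequalizersOfReflectsIsomorphisms
    (MorphismProperty.Over.mapPullbackAdj (MorphismProperty.regularEpi C) ⊤ p hp trivial)⟩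

end Monadicity

/-! ### Closures and commutators as kernels. -/

section Subobjects

variable {C : Type u₁} [Category.{v₁} C] [HasZeroMorphisms C]

theorem IsKernelOf.of_iso {K K' A B : C} {k : K ⟶ A} {f : A ⟶ B} (h : IsKernelOf k f) (i : K' ≅ K)
    (k' : K' ⟶ A) (hk' : i.hom ≫ k = k') : IsKernelOf k' f := by
  subst hk'
  have := h.mono
  refine ⟨mono_comp _ _, by rw [Category.assoc, h.w, comp_zero], fun T t ht => ?_⟩
  obtain ⟨l, hl⟩ := h.lift t ht
  exact ⟨l ≫ i.inv, by rw [Category.assoc, i.inv_hom_id_assoc, hl]⟩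

theorem IsKernelOf.congr {K A B B' : C} {k : K ⟶ A} {f : A ⟶ B} (h : IsKernelOf k f)
    {f' : A ⟶ B'} (hff' : ∀ ⦃T : C⦄ (t : T ⟶ A), t ≫ f = 0 ↔ t ≫ f' = 0) : IsKernelOf k f' :=
  ⟨h.mono, (hff' k).1 h.w, fun _ t ht => h.lift t ((hff' t).2 ht)⟩

theorem IsKernelOf.factors_iff {A B : C} {S : Subobject A} {f : A ⟶ B}
    (h : IsKernelOf S.arrow f) {T : C} (t : T ⟶ A) : S.Factors t ↔ t ≫ f = 0 := by
  constructor
  · intro ht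
    rw [← S.factorThru_arrow t ht, Category.assoc, h.w, comp_zero]
  · intro ht
    obtain ⟨l, hl⟩ := h.lift t ht
    rw [← hl]
    exact S.factors_comp_arrow l

variable [Homological C] {D : Type u₂} [Category.{v₂} D] {L : C ⥤ D} {R : D ⥤ C} (adj : L ⊣ R)

theorem isKernelOf_closure {K A : C} (k : K ⟶ A) [IsNormalMono k] :
    IsKernelOf (closure adj k).arrow (cokernel.π k ≫ unitAt adj (cokernel k)) := by
  have sq := Subobject.isPullback (cokernel.π k) (kernelSubobject (unitAt adj (cokernel k)))
  refine ⟨inferInstance, ?_, fun T t ht => ?_⟩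
  · have := sq.w
    unfold closure
    rw [← reassoc_of% this, kernelSubobject_arrow_comp, comp_zero]
  · have hf : (kernelSubobject (unitAt adj (cokernel k))).Factors (t ≫ cokernel.π k) :=
      kernelSubobject_factors _ _ (by rw [Category.assoc, ht])
    obtain ⟨l, -, hl⟩ := sq.exists_lift (Subobject.factorThru _ _ hf) t
      (Subobject.factorThru_arrow _ _ _)
    exact ⟨l, hl⟩

section RelativeCommutator

variable {A B : C} (f : A ⟶ B) (j : kernel f ⟶ pullback f f)

/-- The inclusion of `K[f]` in the second factor of the kernel pair of `f` is a kernel of the first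
projection. -/
theorem isKernelOf_pullback_fst (hj₁ : j ≫ pullback.fst f f = 0)
    (hj₂ : j ≫ pullback.snd f f = kernel.ι f) : IsKernelOf j (pullback.fst f f) := by
  refine ⟨?_, hj₁, fun T t ht => ?_⟩
  · have : Mono (j ≫ pullback.snd f f) := by rw [hj₂]; infer_instance
    exact mono_of_mono j (pullback.snd f f)
  · refine ⟨kernel.lift f (t ≫ pullback.snd f f) ?_, pullback.hom_ext ?_ ?_⟩
    · rw [Category.assoc, ← pullback.condition, reassoc_of% ht, zero_comp]
    · rw [Category.assoc, hj₁, comp_zero, ht]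
    · rw [Category.assoc, hj₂, kernel.lift_ι]

/-- The first projection already vanishes on `j`, so the only condition left on an element of `K[f]`
is that the unit at the kernel pair kill it. -/
theorem isKernelOf_relativeCommutator_toKernel (hj₁ : j ≫ pullback.fst f f = 0)
    (hj₂ : j ≫ pullback.snd f f = kernel.ι f) :
    IsKernelOf (relativeCommutator.toKernel adj f) (j ≫ unitAt adj (pullback f f)) := by
  have hcomp : relativeCommutator.toKernel adj f ≫ j =
      kernel.ι (unitKernelMap adj (pullback.fst f f)) ≫
        kernel.ι (unitAt adj (pullback f f)) := by
    apply pullback.hom_ext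
    · rw [Category.assoc, hj₁, comp_zero, Category.assoc, relativeCommutator.fst_eq_zero]
    · rw [Category.assoc, hj₂, Category.assoc, ← relativeCommutator.ι_eq]
      exact kernel.lift_ι _ _ _
  have := (isKernelOf_pullback_fst f j hj₁ hj₂).mono
  refine ⟨?_, ?_, fun T t ht => ?_⟩
  · have : Mono (relativeCommutator.toKernel adj f ≫ j) := by
      rw [hcomp]; exact mono_comp _ _
    exact mono_of_mono _ j
  · rw [reassoc_of% hcomp, kernel.condition, comp_zero]
  · have h₁ : (t ≫ j) ≫ unitAt adj (pullback f f) = 0 := by rw [Category.assoc]; exact ht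
    refine ⟨kernel.lift _ (kernel.lift _ (t ≫ j) h₁) ?_, ?_⟩
    · rw [← cancel_mono (kernel.ι (unitAt adj A))]
      rw [Category.assoc, unitKernelMap_comp_ι, kernel.lift_ι_assoc, Category.assoc, hj₁,
        comp_zero, zero_comp]
    · rw [← cancel_mono j, Category.assoc, hcomp]
      rw [kernel.lift_ι_assoc, kernel.lift_ι]

end RelativeCommutator

open ZeroObject in
/-- The self-commutator `[A, A]` is the kernel of the unit. -/
theorem isKernelOf_selfCommutator_ι (A : C) :
    IsKernelOf (selfCommutator.ι adj A) (unitAt adj A) := by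
  -- Here `kernel.ι` is invertible, so up to this isomorphism `j` is a section of the second
  -- projection. Naturality of the unit along both maps shows that an element of `A` is killed by
  -- the unit exactly when its image under `j` is.
  obtain ⟨j, hj₁, hj₂⟩ := exists_pullback_lift (0 : A ⟶ (0 : C)) (0 : A ⟶ (0 : C)) 0
    (kernel.ι (0 : A ⟶ (0 : C))) (by simp)
  have h := isKernelOf_relativeCommutator_toKernel adj _ j hj₁ hj₂
  have hfac : relativeCommutator.toKernel adj (0 : A ⟶ (0 : C)) ≫ kernel.ι (0 : A ⟶ (0 : C)) =
      selfCommutator.ι adj A := kernel.lift_ι _ _ _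
  have := h.mono
  refine ⟨by rw [← hfac]; exact mono_comp _ _, ?_, fun T t ht => ?_⟩
  · rw [← hfac, ← hj₂, Category.assoc, Category.assoc, ← unitAt_naturality, reassoc_of% h.w,
      zero_comp]
  · let t' := kernel.lift (0 : A ⟶ (0 : C)) t (by simp)
    have ht' : t' ≫ kernel.ι (0 : A ⟶ (0 : C)) = t := kernel.lift_ι _ _ _
    obtain ⟨l, hl⟩ := h.lift t' (by
      have h1 := comp_unitAt_eq_zero adj t (inv (kernel.ι (0 : A ⟶ (0 : C))) ≫ j) ht
      rw [← ht'] at h1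
      simpa only [Category.assoc, IsIso.hom_inv_id_assoc] using h1)
    exact ⟨l, by rw [← hfac, reassoc_of% hl, ht']⟩

end Subobjects

/-! ### The composite reflection and the role of protoadditivity. -/

section Composite

variable {𝒜 : Type*} [Category* 𝒜] {ℬ : Type*} [Category* ℬ] {ℱ : Type*} [Category* ℱ]
  {I : 𝒜 ⥤ ℬ} {H : ℬ ⥤ 𝒜} (adj₁ : I ⊣ H) {F : ℬ ⥤ ℱ} {U : ℱ ⥤ ℬ} (adj₂ : F ⊣ U)

theorem unitAt_comp (X : 𝒜) : unitAt (adj₁.comp adj₂) X =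
    unitAt adj₁ X ≫ H.map (unitAt adj₂ (I.obj X)) := by
  simp [unitAt]

/-- The inclusion of a Birkhoff subcategory preserves regular epimorphisms. -/
theorem isRegularEpi_map_of_isBirkhoff [H.Full] [H.Faithful] [Regular 𝒜] (hℬ : IsBirkhoff adj₁)
    {Z Z' : ℬ} (g : Z ⟶ Z') [IsRegularEpi g] : IsRegularEpi (H.map g) := by
  obtain ⟨J, e, m, he, hm, hem⟩ := exists_regularEpi_mono_fac (H.map g)
  -- The image of `H.map g` is a quotient of an object of `ℬ`, so the factorization lives in `ℬ`.
  -- There `g` is a strong epimorphism, which forces its monic part to be invertible.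
  obtain ⟨V, ⟨i⟩⟩ := hℬ.quotient_closed e he (H.obj_mem_essImage _)
  obtain ⟨e', he'⟩ := H.map_surjective (e ≫ i.inv)
  obtain ⟨m', hm'⟩ := H.map_surjective (i.hom ≫ m)
  have hg : e' ≫ m' = g := H.map_injective (by
    rw [H.map_comp, he', hm', Category.assoc, i.inv_hom_id_assoc, hem])
  have : Mono (H.map m') := by rw [hm']; exact mono_comp _ _
  have : Mono m' := H.mono_of_mono_map this
  have : StrongEpi (e' ≫ m') := by rw [hg]; infer_instance
  have : StrongEpi m' := strongEpi_of_strongEpi e' m'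
  have : IsIso m' := isIso_of_mono_of_strongEpi m'
  have : IsIso (i.hom ≫ m) := by rw [← hm']; infer_instance
  have : IsIso m := IsIso.of_isIso_comp_left i.hom m
  rw [← hem]
  infer_instance

theorem isRegularEpiReflective_comp [H.Full] [H.Faithful] [U.Full] [U.Faithful] [Regular 𝒜]
    (hℬ : IsBirkhoff adj₁) (hℱ : IsRegularEpiReflective adj₂) :
    IsRegularEpiReflective (adj₁.comp adj₂) := ⟨fun X => by
  have := hℬ.regularEpi_unit X
  have := hℱ.regularEpi_unit (I.obj X)
  have := isRegularEpi_map_of_isBirkhoff adj₁ hℬ (unitAt adj₂ (I.obj X))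
  rw [unitAt_comp]
  exact isRegularEpi_comp _ _⟩

variable [HasZeroMorphisms 𝒜] [HasZeroMorphisms ℬ] [HasZeroMorphisms ℱ] [Homological 𝒜]
  [H.Full] [H.Faithful]

/-- A split epimorphism of a reflective subcategory of a homological category is a cokernel of its
kernel. -/
theorem isSplitShortExact_of_isKernelOf (adj : I ⊣ H) {Z X Y : ℬ} (z : Z ⟶ X) (a : X ⟶ Y)
    (s : Y ⟶ X) (hs : s ≫ a = 𝟙 Y) (hz : IsKernelOf z a) : IsSplitShortExact z a s := by
  have : PreservesLimitsOfSize.{0, 0} H := adj.rightAdjoint_preservesLimits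
  have hHz := hz.map H
  have hreg : IsRegularEpi (H.map a) :=
    isRegularEpi_of_section _ (H.map s) (by rw [← H.map_comp, hs, H.map_id])
  have hepi : IsSplitEpi a := ⟨⟨⟨s, hs⟩⟩⟩
  -- The factorization is found in the larger category, where `H.map a` is a cokernel of its kernel,
  -- and returns to `ℬ` because `H` is full and faithful.
  have key : ∀ {G : ℬ} (g : X ⟶ G), z ≫ g = 0 → a ≫ s ≫ g = g := by
    intro G g hg
    obtain ⟨l, hl⟩ := exists_desc_of_kernel hHz (H.map g) (by rw [← H.map_comp, hg, H.map_zero])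
    obtain ⟨l, rfl⟩ := H.map_surjective l
    have hl' : a ≫ l = g := H.map_injective (by rw [H.map_comp, hl])
    rw [← hl', reassoc_of% hs]
  exact { w := hz.w, isKernel := hz.nonempty_isLimit, splitting := hs
          isCokernel := ⟨CokernelCofork.IsColimit.ofπ' a hz.w fun g hg => ⟨s ≫ g, key g hg⟩⟩ }

/-- For a split epimorphism `a : X ⟶ Y` and a protoadditive second reflector, a morphism from
`K[a]` to an object of the smaller subcategory which annihilates `K[a] ∧ K[η¹]` also annihilates
`K[a] ∧ K[η]`. -/
theorem comp_eq_zero_of_isProtoadditive (hℬ : IsRegularEpiReflective adj₁)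
    (hproto : IsProtoadditive F) {K X Y : 𝒜} (a : X ⟶ Y) (s : Y ⟶ X) (hs : s ≫ a = 𝟙 Y)
    {κ : K ⟶ X} (hκ : IsKernelOf κ a) {V : 𝒜} (hV : (U ⋙ H).essImage V) (w : K ⟶ V)
    (hw : ∀ ⦃T : 𝒜⦄ (t : T ⟶ K), t ≫ κ ≫ unitAt adj₁ X = 0 → t ≫ w = 0) {T : 𝒜} (t : T ⟶ K)
    (ht : t ≫ κ ≫ unitAt (adj₁.comp adj₂) X = 0) : t ≫ w = 0 := by
  have : HasFiniteLimits ℬ := hasFiniteLimits_of_adjunction adj₁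
  have : PreservesLimitsOfSize.{0, 0} H := adj₁.rightAdjoint_preservesLimits
  obtain ⟨V, ⟨i⟩⟩ := hV
  let z := kernel.ι (I.map a)
  have hz : IsKernelOf z (I.map a) := IsKernelOf.kernel_ι _
  have hHz := hz.map H
  have := hHz.mono
  -- `e` is the restriction of `η¹` to `K[a] ⟶ H K[I a]`, a regular epimorphism since `a` is split.
  -- So `w` descends along `e`, and then along the unit of `adj₂`, its target being in the smaller
  -- subcategory.
  obtain ⟨e, he⟩ := hHz.lift (κ ≫ unitAt adj₁ X) (by
    rw [Category.assoc, unitAt_naturality, reassoc_of% hκ.w, zero_comp])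
  have hereg : IsRegularEpi e := by
    obtain ⟨T', c, l, hc, hl₁, hl₂⟩ := exists_kernel_cover_unitAt adj₁ hℬ a s hs (H.map z) hHz.w
    obtain ⟨l, rfl⟩ := hκ.lift l hl₁
    refine isRegularEpi_of_comp l e ?_
    have : l ≫ e = c := by rw [← cancel_mono (H.map z), Category.assoc, he, ← hl₂, Category.assoc]
    rwa [this]
  obtain ⟨w', hw'⟩ := exists_desc_of_forall e (w ≫ i.inv) fun T t ht => by
    rw [← Category.assoc, hw t (by rw [← he, reassoc_of% ht, zero_comp]), zero_comp]
  obtain ⟨w', rfl⟩ : ∃ w'' : kernel (I.map a) ⟶ U.obj V, H.map w'' = w' := H.map_surjective w'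
  obtain ⟨v, rfl⟩ := exists_unitAt_fac adj₂ w'
  have hF := (hproto _ _ _ (isSplitShortExact_of_isKernelOf adj₁ z (I.map a) (I.map s)
    (by rw [← I.map_comp, hs, I.map_id]) hz)).isKernel
  -- Protoadditivity enters here: as `F.map z` is monic, an element of `K[I a]` killed by the unit
  -- of `adj₂` at `I X` is already killed by the unit at `K[I a]`.
  have : Mono (F.map z) := (IsKernelOf.of_isLimit hF.some).mono
  have : (U ⋙ H).PreservesMonomorphisms :=
    Functor.preservesMonomorphisms_of_adjunction (adj₁.comp adj₂)
  have hm : Mono (H.map (U.map (F.map z))) := inferInstanceAs (Mono ((U ⋙ H).map (F.map z)))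
  have h0 : t ≫ e ≫ H.map (unitAt adj₂ _) = 0 := by
    rw [← cancel_mono (H.map (U.map (F.map z))), zero_comp, Category.assoc, Category.assoc,
      ← H.map_comp, unitAt_naturality, H.map_comp, reassoc_of% he, ← unitAt_comp, ht]
  rw [← cancel_mono i.inv, zero_comp, Category.assoc, ← hw', H.map_comp, reassoc_of% h0, zero_comp]

end Composite

/-! ### Trivial extensions and the Galois group as `K[p] ∧ K[η_E]`. -/

section GaloisGroup

variable {C : Type u₁} [Category.{v₁} C] [HasZeroMorphisms C]

/-- The morphism `n` is the intersection of the kernels of `f` and `g`. -/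
structure IsKernelMeet {N A B B' : C} (n : N ⟶ A) (f : A ⟶ B) (g : A ⟶ B') : Prop where
  mono : Mono n
  w₁ : n ≫ f = 0
  w₂ : n ≫ g = 0
  lift : ∀ ⦃T : C⦄ (t : T ⟶ A), t ≫ f = 0 → t ≫ g = 0 → ∃ l : T ⟶ N, l ≫ n = t

variable {D : Type u₂} [Category.{v₂} D] {L : C ⥤ D} {R : D ⥤ C} (adj : L ⊣ R)

/-- In a trivial extension an element is determined by its images in the base and in the
reflection; in particular a trivial element of the kernel of the unit is zero. -/
theorem eq_zero_of_isTrivialExtension [Regular C] {X Y : C} {a : X ⟶ Y}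
    (h : IsTrivialExtension adj a) {T : C} (t : T ⟶ X) (h₁ : t ≫ a = 0)
    (h₂ : t ≫ unitAt adj X = 0) : t = 0 :=
  h.isPullback.hom_ext (by rw [h₂, zero_comp]) (by rw [h₁, zero_comp])

/-- An endomorphism of a normal extension acts trivially on the kernel of the unit. -/
theorem comp_endo_eq_of_isTrivialExtension [Regular C] {E B : C} {p : E ⟶ B}
    (h : IsTrivialExtension adj (pullback.fst p p)) (x : E ⟶ E) (hx : x ≫ p = p) {T : C}
    (t : T ⟶ E) (ht : t ≫ unitAt adj E = 0) : t ≫ x = t := by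
  obtain ⟨d, hd₁, hd₂⟩ := exists_pullback_lift p p (𝟙 E) (𝟙 E) rfl
  obtain ⟨y, hy₁, hy₂⟩ := exists_pullback_lift p p (𝟙 E) x (by rw [hx, Category.id_comp])
  -- The elements `(t, t)` and `(t, t ≫ x)` of the kernel pair have the same first projection and
  -- are both killed by the unit, so the pullback property identifies them.
  have : t ≫ d = t ≫ y := h.isPullback.hom_ext
    (by rw [comp_unitAt_eq_zero adj t d ht, comp_unitAt_eq_zero adj t y ht])
    (by rw [Category.assoc, hd₁, Category.assoc, hy₁])
  rw [← hy₂, ← reassoc_of% this, hd₂, Category.comp_id]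

/-- The intersections of the kernels of the extension and of the unit are isomorphic for any two
weakly universal normal extensions of the same object. -/
theorem nonempty_iso_of_isWeaklyUniversal [Regular C] {E E' B : C} {p : E ⟶ B} {p' : E' ⟶ B}
    (hp : IsWeaklyUniversalNormalExtension adj p) (hp' : IsWeaklyUniversalNormalExtension adj p')
    {N N' : C} {n : N ⟶ E} {n' : N' ⟶ E'} (hn : IsKernelMeet n p (unitAt adj E))
    (hn' : IsKernelMeet n' p' (unitAt adj E')) : Nonempty (N ≅ N') := by
  obtain ⟨u, hu⟩ := hp.weaklyUniversal p' hp'.normal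
  obtain ⟨v, hv⟩ := hp'.weaklyUniversal p hp.normal
  obtain ⟨a, ha⟩ := hn'.lift (n ≫ u) (by rw [Category.assoc, hu, hn.w₁])
    (comp_unitAt_eq_zero adj n u hn.w₂)
  obtain ⟨b, hb⟩ := hn.lift (n' ≫ v) (by rw [Category.assoc, hv, hn'.w₁])
    (comp_unitAt_eq_zero adj n' v hn'.w₂)
  have := hn.mono
  have := hn'.mono
  refine ⟨⟨a, b, ?_, ?_⟩⟩
  · rw [← cancel_mono n, Category.assoc, hb, reassoc_of% ha, Category.id_comp]
    exact comp_endo_eq_of_isTrivialExtension adj hp.normal.trivial_pullback (u ≫ v)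
      (by rw [Category.assoc, hv, hu]) n hn.w₂
  · rw [← cancel_mono n', Category.assoc, ha, reassoc_of% hb, Category.id_comp]
    exact comp_endo_eq_of_isTrivialExtension adj hp'.normal.trivial_pullback (v ≫ u)
      (by rw [Category.assoc, hu, hv]) n' hn'.w₂

/-- The Galois group of a normal extension `p : E ⟶ B` is `K[p] ∧ K[η_E]`. -/
theorem exists_isKernelMeet_galoisGroup [Homological C] [HasZeroMorphisms D] [R.Full] [R.Faithful]
    {E B : C} {p : E ⟶ B} (h : IsTrivialExtension adj (pullback.fst p p)) :
    ∃ n : R.obj (galoisGroup adj p) ⟶ E, IsKernelMeet n p (unitAt adj E) := by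
  have : HasFiniteLimits D := hasFiniteLimits_of_adjunction adj
  have : PreservesLimitsOfSize.{0, 0} R := adj.rightAdjoint_preservesLimits
  obtain ⟨ι, hι⟩ : ∃ ι : galoisGroup adj p ⟶ L.obj (pullback p p),
      IsKernelOf ι (prod.lift (L.map (pullback.fst p p)) (L.map (pullback.snd p p))) :=
    ⟨_, IsKernelOf.kernel_ι _⟩
  have hι₁ : ι ≫ L.map (pullback.fst p p) = 0 := by
    rw [← prod.lift_fst (L.map (pullback.fst p p)) (L.map (pullback.snd p p)),
      reassoc_of% hι.w, zero_comp]
  have hι₂ : ι ≫ L.map (pullback.snd p p) = 0 := by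
    rw [← prod.lift_snd (L.map (pullback.fst p p)) (L.map (pullback.snd p p)),
      reassoc_of% hι.w, zero_comp]
  have := (hι.map R).mono
  have hlift : ∀ {T : C} (t : T ⟶ R.obj (L.obj (pullback p p))),
      t ≫ R.map (L.map (pullback.fst p p)) = 0 → t ≫ R.map (L.map (pullback.snd p p)) = 0 →
      ∃ l, l ≫ R.map ι = t := by
    intro T t h₁ h₂
    obtain ⟨v, rfl⟩ := exists_unitAt_fac adj t
    have hv₁ : v ≫ L.map (pullback.fst p p) = 0 := unitAt_comp_map_injective adj (by
      rw [R.map_comp, R.map_zero, comp_zero, ← h₁, Category.assoc])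
    have hv₂ : v ≫ L.map (pullback.snd p p) = 0 := unitAt_comp_map_injective adj (by
      rw [R.map_comp, R.map_zero, comp_zero, ← h₂, Category.assoc])
    obtain ⟨l, rfl⟩ := hι.lift v (by
      apply Limits.prod.hom_ext
      · rw [Category.assoc, prod.lift_fst, hv₁, zero_comp]
      · rw [Category.assoc, prod.lift_snd, hv₂, zero_comp])
    exact ⟨unitAt adj T ≫ R.map l, by rw [Category.assoc, ← R.map_comp]⟩
  -- Triviality identifies the kernel of the first projection with the kernel of its reflection.
  -- Thus `m` embeds the Galois group as the elements `(0, e)`, and vanishing of the other reflected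
  -- projection says that the unit kills `e`.
  obtain ⟨m, hm₁, hm₂⟩ := h.isPullback.exists_lift (R.map ι) (0 : _ ⟶ E) (by
    rw [← R.map_comp, hι₁, R.map_zero, zero_comp])
  refine ⟨m ≫ pullback.snd p p, ?_, ?_, ?_, fun T t h₁ h₂ => ?_⟩
  · refine mono_of_kernel_trivial _ fun T t ht => ?_
    have h0 : t ≫ m = 0 := by
      apply pullback.hom_ext
      · rw [Category.assoc, hm₂, comp_zero, zero_comp]
      · rw [Category.assoc, ht, zero_comp]
    rw [← cancel_mono (R.map ι), ← hm₁, reassoc_of% h0, zero_comp, zero_comp]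
  · rw [Category.assoc, ← pullback.condition, reassoc_of% hm₂, zero_comp]
  · rw [Category.assoc, ← unitAt_naturality, reassoc_of% hm₁, ← R.map_comp, hι₂, R.map_zero]
  · obtain ⟨y, hy₁, hy₂⟩ := exists_pullback_lift p p 0 t (by rw [h₁, zero_comp])
    obtain ⟨l, hl⟩ := hlift (y ≫ unitAt adj _)
      (by rw [Category.assoc, unitAt_naturality, reassoc_of% hy₁, zero_comp])
      (by rw [Category.assoc, unitAt_naturality, reassoc_of% hy₂, h₂])
    have hlm : l ≫ m = y := h.isPullback.hom_ext (by rw [Category.assoc, hm₁, hl])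
      (by rw [Category.assoc, hm₂, comp_zero, hy₁])
    exact ⟨l, by rw [reassoc_of% hlm, hy₂]⟩

/-- A split epimorphism whose kernel meets the kernel of the unit trivially is a trivial
extension. -/
theorem isTrivialExtension_of_section [Homological C] [R.Full] [R.Faithful]
    (hR : IsRegularEpiReflective adj) {X Y : C} (a : X ⟶ Y) (s : Y ⟶ X) (hs : s ≫ a = 𝟙 Y)
    (h : ∀ ⦃T : C⦄ (t : T ⟶ X), t ≫ a = 0 → t ≫ unitAt adj X = 0 → t = 0) :
    IsTrivialExtension adj a := by
  have hreg := isRegularEpi_of_section a s hs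
  refine ⟨hreg, ?_⟩
  -- The kernel of the comparison `c` is `K[a] ∧ K[η]`, trivial by `h`. It is a regular epimorphism
  -- because `a` is split, which makes `K[a] ⟶ K[R L a]` one.
  obtain ⟨c, hc₁, hc₂⟩ := exists_pullback_lift (R.map (L.map a)) (unitAt adj Y) (unitAt adj X) a
    (unitAt_naturality adj a)
  have hmono : Mono c := mono_of_kernel_trivial c fun T t ht =>
    h t (by rw [← hc₂, reassoc_of% ht, zero_comp]) (by rw [← hc₁, reassoc_of% ht, zero_comp])
  let κ := kernel.ι (pullback.snd (R.map (L.map a)) (unitAt adj Y))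
  obtain ⟨T', e, l, he, hl₁, hl₂⟩ := exists_kernel_cover_unitAt adj hR a s hs (κ ≫ pullback.fst _ _)
    (by rw [Category.assoc, pullback.condition, kernel.condition_assoc, zero_comp])
  have hcreg : IsRegularEpi c := by
    refine isRegularEpi_of_kernel_covered c (pullback.snd _ _) (by rwa [hc₂]) e l ?_
    apply pullback.hom_ext
    · rw [Category.assoc, hc₁, hl₂, Category.assoc]
    · rw [Category.assoc, hc₂, hl₁, Category.assoc, kernel.condition, comp_zero]
  have := isIso_of_mono_of_strongEpi c
  exact IsPullback.of_iso_pullback ⟨unitAt_naturality adj a⟩ (asIso c) hc₁ hc₂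

end GaloisGroup

/-! ### Numerator and denominator of the formula as kernels. -/

section HopfFormula

variable {𝒜 : Type*} [Category* 𝒜] [HasZeroMorphisms 𝒜]
  {ℬ : Type*} [Category* ℬ] {ℱ : Type*} [Category* ℱ]
  {I : 𝒜 ⥤ ℬ} {H : ℬ ⥤ 𝒜} (adj₁ : I ⊣ H) {F : ℬ ⥤ ℱ} {U : ℱ ⥤ ℬ} (adj₂ : F ⊣ U)

theorem comp_unitAt_comp_eq_zero {T X : 𝒜} (t : T ⟶ X) (ht : t ≫ unitAt adj₁ X = 0) :
    t ≫ unitAt (adj₁.comp adj₂) X = 0 := by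
  rw [unitAt_comp, reassoc_of% ht, zero_comp]

/-- The closure of `[P, P]` is the kernel of the unit of the composite reflection. -/
theorem isKernelOf_closure_selfCommutator [Homological 𝒜] (P : 𝒜) :
    IsKernelOf (closure (adj₁.comp adj₂) (selfCommutator.ι adj₁ P)).arrow
      (unitAt (adj₁.comp adj₂) P) := by
  refine (isKernelOf_closure _ _).congr fun T t => ⟨fun ht => ?_, fun ht => ?_⟩
  · rw [← cokernel.π_desc (selfCommutator.ι adj₁ P) (unitAt (adj₁.comp adj₂) P)
      (comp_unitAt_comp_eq_zero adj₁ adj₂ _ (isKernelOf_selfCommutator_ι adj₁ P).w),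
      ← Category.assoc]
    exact comp_eq_zero_of_comp_unitAt (adj₁.comp adj₂) ((U ⋙ H).obj_mem_essImage _) _ _
      (by rw [Category.assoc, ht])
  · rw [← Category.assoc]
    exact comp_unitAt_eq_zero _ _ _ ht

/-- The closure of `[K[f], P]` in `K[f]` is the intersection of `K[f]` with the kernel of the unit
of the composite reflection at the kernel pair of `f`. -/
theorem isKernelOf_closure_relativeCommutator [Homological 𝒜] [HasZeroMorphisms ℬ]
    [HasZeroMorphisms ℱ] [H.Full] [H.Faithful] (hℬ : IsRegularEpiReflective adj₁)
    (hproto : IsProtoadditive F) {P B : 𝒜} (f : P ⟶ B) (j : kernel f ⟶ pullback f f)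
    (hj₁ : j ≫ pullback.fst f f = 0) (hj₂ : j ≫ pullback.snd f f = kernel.ι f) :
    IsKernelOf (closure (adj₁.comp adj₂) (relativeCommutator.toKernel adj₁ f)).arrow
      (j ≫ unitAt (adj₁.comp adj₂) (pullback f f)) := by
  have hc := isKernelOf_relativeCommutator_toKernel adj₁ f j hj₁ hj₂
  refine (isKernelOf_closure _ _).congr fun T t => ⟨fun ht => ?_, fun ht => ?_⟩
  · rw [← cokernel.π_desc (relativeCommutator.toKernel adj₁ f)
      (j ≫ unitAt (adj₁.comp adj₂) (pullback f f)) (by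
        rw [← Category.assoc]
        exact comp_unitAt_comp_eq_zero adj₁ adj₂ _ (by rw [Category.assoc, hc.w])),
      ← Category.assoc]
    exact comp_eq_zero_of_comp_unitAt (adj₁.comp adj₂) ((U ⋙ H).obj_mem_essImage _) _ _
      (by rw [Category.assoc, ht])
  -- The diagonal splits the first projection, so by protoadditivity it is enough that the map
  -- defining the closure vanish on `K[f] ∧ K[η¹]`, which is the commutator being divided out.
  · obtain ⟨d, hd₁, -⟩ := exists_pullback_lift f f (𝟙 P) (𝟙 P) rfl
    refine comp_eq_zero_of_isProtoadditive adj₁ adj₂ hℬ hproto (pullback.fst f f) d hd₁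
      (isKernelOf_pullback_fst f j hj₁ hj₂) ((U ⋙ H).obj_mem_essImage _) _ (fun T t ht => ?_) t ht
    obtain ⟨l, rfl⟩ := hc.lift t ht
    rw [Category.assoc, cokernel.condition_assoc, zero_comp, comp_zero]

end HopfFormula

/-! ### Construction of the weakly universal normal extension. -/

section HopfFormula

variable {𝒜 : Type*} [Category* 𝒜] [HasZeroMorphisms 𝒜] [SemiAbelian 𝒜]

section Quotient

variable {ℰ : Type*} [Category* ℰ] {L : 𝒜 ⥤ ℰ} {R : ℰ ⥤ 𝒜} (adj : L ⊣ R) {P B : 𝒜} (f : P ⟶ B)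
  {j : kernel f ⟶ pullback f f} {K₀ : 𝒜} {d : K₀ ⟶ kernel f}

/-- The intersection of `K[f]` with the kernel of the unit at the kernel pair of `f` is normal in
the domain of `f`. -/
theorem isNormalMono_of_isKernelOf (hj₁ : j ≫ pullback.fst f f = 0)
    (hj₂ : j ≫ pullback.snd f f = kernel.ι f)
    (hd : IsKernelOf d (j ≫ unitAt adj (pullback f f))) : IsNormalMono (d ≫ kernel.ι f) := by
  have := hd.mono
  have hj := isKernelOf_pullback_fst f j hj₁ hj₂
  have := hj.mono
  -- As the kernel of `c`, the map `d ≫ j` is normal in the kernel pair. The second projection is a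
  -- split epimorphism, so the image `d ≫ kernel.ι f` is normal in `P`.
  obtain ⟨c, hc₁, hc₂⟩ := exists_prod_lift (pullback.fst f f) (unitAt adj (pullback f f))
  have hk : IsKernelOf (d ≫ j) c := by
    refine ⟨mono_comp _ _, ?_, fun T t ht => ?_⟩
    · apply Limits.prod.hom_ext
      · rw [Category.assoc, Category.assoc, hc₁, hj₁, comp_zero, zero_comp]
      · rw [Category.assoc, Category.assoc, hc₂, hd.w, zero_comp]
    · obtain ⟨l, rfl⟩ := hj.lift t (by rw [← hc₁, reassoc_of% ht, zero_comp])
      obtain ⟨l, rfl⟩ := hd.lift l (by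
        rw [← Category.assoc, ← hc₂, ← Category.assoc, ht, zero_comp])
      exact ⟨l, by rw [Category.assoc]⟩
  obtain ⟨s, -, hs₂⟩ := exists_pullback_lift f f (𝟙 P) (𝟙 P) rfl
  have := isRegularEpi_of_section _ s hs₂
  exact isNormalMono_image (d ≫ j) hk.isNormalMono (pullback.snd f f) (𝟙 _) (d ≫ kernel.ι f)
    (by rw [Category.id_comp, Category.assoc, hj₂])

/-- The quotient of a projective presentation by `K[f] ∧ K[η]` factors through every normal
extension. -/
theorem exists_fac_of_isNormalExtension (hf : IsProjectivePresentation f)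
    (hj₁ : j ≫ pullback.fst f f = 0) (hj₂ : j ≫ pullback.snd f f = kernel.ι f)
    (hd : IsKernelOf d (j ≫ unitAt adj (pullback f f))) {E : 𝒜} (q : P ⟶ E) [IsRegularEpi q]
    (p : E ⟶ B) (hqp : q ≫ p = f) (hq : IsKernelOf (d ≫ kernel.ι f) q) {E' : 𝒜} (p' : E' ⟶ B)
    (hp' : IsNormalExtension adj p') : ∃ u : E ⟶ E', u ≫ p' = p := by
  obtain ⟨h, hh⟩ := hf.projective p' f hp'.monadicExtension.regularEpi
  obtain ⟨y, hy₁, hy₂⟩ := exists_pullback_lift p' p' (pullback.fst f f ≫ h) (pullback.snd f f ≫ h)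
    (by rw [Category.assoc, Category.assoc, hh, pullback.condition])
  -- The map `y` induced by `h` on kernel pairs sends `K₀` into `K[pullback.fst p' p'] ∧ K[η]`,
  -- which is zero since `p'` is normal. Hence `h` kills the kernel of `q`.
  have h0 : (d ≫ j) ≫ y = 0 := eq_zero_of_isTrivialExtension adj hp'.trivial_pullback _
    (by rw [Category.assoc, Category.assoc, hy₁, reassoc_of% hj₁, zero_comp, comp_zero])
    (comp_unitAt_eq_zero adj _ _ (by rw [Category.assoc, hd.w]))
  obtain ⟨u, hu⟩ := exists_desc_of_kernel hq h (by
    rw [← hj₂, Category.assoc, Category.assoc, ← hy₂, ← Category.assoc, ← Category.assoc, h0,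
      zero_comp])
  exact ⟨u, by rw [← cancel_epi q, reassoc_of% hu, hh, hqp]⟩

end Quotient

variable {ℬ : Type*} [Category* ℬ] [HasZeroMorphisms ℬ] {ℱ : Type*} [Category* ℱ]
  [HasZeroMorphisms ℱ] {I : 𝒜 ⥤ ℬ} {H : ℬ ⥤ 𝒜} [H.Full] [H.Faithful] (adj₁ : I ⊣ H)
  {F : ℬ ⥤ ℱ} {U : ℱ ⥤ ℬ} [U.Full] [U.Faithful] (adj₂ : F ⊣ U)

/-- The quotient `P / (K[f] ∧ K[η]) ⟶ B` of an extension `f : P ⟶ B` is a normal extension. -/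
theorem isNormalExtension_quotient (hℬ : IsBirkhoff adj₁) (hℱ : IsRegularEpiReflective adj₂)
    (hproto : IsProtoadditive F) {P B : 𝒜} (f : P ⟶ B) (hf : IsRegularEpi f)
    {j : kernel f ⟶ pullback f f} (hj₁ : j ≫ pullback.fst f f = 0)
    (hj₂ : j ≫ pullback.snd f f = kernel.ι f) {K₀ : 𝒜} {d : K₀ ⟶ kernel f}
    (hd : IsKernelOf d (j ≫ unitAt (adj₁.comp adj₂) (pullback f f))) {E : 𝒜} (q : P ⟶ E)
    [hqreg : IsRegularEpi q] (p : E ⟶ B) (hqp : q ≫ p = f)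
    (hq : IsKernelOf (d ≫ kernel.ι f) q) : IsNormalExtension (adj₁.comp adj₂) p := by
  have hj := isKernelOf_pullback_fst f j hj₁ hj₂
  have hpreg : IsRegularEpi p := isRegularEpi_of_comp q p (by rwa [hqp])
  have hR := isRegularEpiReflective_comp adj₁ adj₂ hℬ hℱ
  have hiff : ∀ {T : 𝒜} (t : T ⟶ kernel f), t ≫ kernel.ι f ≫ q = 0 ↔
      t ≫ j ≫ unitAt (adj₁.comp adj₂) (pullback f f) = 0 := by
    intro T t
    constructor
    · intro ht
      obtain ⟨l, hl⟩ := hq.lift (t ≫ kernel.ι f) (by rw [Category.assoc, ht])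
      have hl' : l ≫ d = t := by rw [← cancel_mono (kernel.ι f), Category.assoc, hl]
      rw [← hl', Category.assoc, hd.w, comp_zero]
    · intro ht
      obtain ⟨l, rfl⟩ := hd.lift t ht
      have := hq.w
      rw [Category.assoc] at this
      rw [Category.assoc, this, comp_zero]
  -- the quotient `K[f] ⟶ K[p]`, whose codomain lies in the smaller subcategory
  obtain ⟨k, hk⟩ := (IsKernelOf.kernel_ι p).lift (kernel.ι f ≫ q)
    (by rw [Category.assoc, hqp, kernel.condition])
  have hkreg : IsRegularEpi k := by
    obtain ⟨l, hl⟩ := (IsKernelOf.kernel_ι f).lift (pullback.snd (kernel.ι p) q) (by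
      rw [← hqp, ← pullback.condition_assoc, kernel.condition, comp_zero])
    refine isRegularEpi_of_comp l k ?_
    have : l ≫ k = pullback.fst (kernel.ι p) q := by
      rw [← cancel_mono (kernel.ι p), Category.assoc, hk, reassoc_of% hl, pullback.condition]
    rw [this]
    infer_instance
  have hkiff : ∀ {T : 𝒜} (t : T ⟶ kernel f), t ≫ k = 0 ↔
      t ≫ j ≫ unitAt (adj₁.comp adj₂) (pullback f f) = 0 := by
    intro T t
    rw [← hiff, ← hk, ← Category.assoc, ← cancel_mono (kernel.ι p), zero_comp]
  -- `k` and the unit restricted along `j` have the same kernel, so `K[p]` embeds in the reflection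
  -- of the kernel pair of `f`; the subcategory is closed under subobjects.
  obtain ⟨m, hm⟩ := exists_desc_of_forall k (j ≫ unitAt (adj₁.comp adj₂) (pullback f f))
    fun T t ht => (hkiff t).1 ht
  have hmono : Mono m := mono_of_regularEpi_comp k m fun T t ht => (hkiff t).2 (by rwa [hm] at ht)
  have hK : (U ⋙ H).essImage (kernel p) := essImage_of_mono _ hR m ((U ⋙ H).obj_mem_essImage _)
  -- the pullback of `p` along `f`
  obtain ⟨θ, hθ₁, hθ₂⟩ := exists_pullback_lift f p (pullback.fst f f) (pullback.snd f f ≫ q)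
    (by rw [Category.assoc, hqp, pullback.condition])
  have hθ : IsRegularEpi θ := by
    refine isRegularEpi_of_isPullback
      (IsPullback.of_right ?_ hθ₂ (IsPullback.of_hasPullback f p)) hqreg
    rw [hθ₁, hqp]
    exact IsPullback.of_hasPullback f f
  obtain ⟨v, hv⟩ := exists_desc_of_forall θ (unitAt (adj₁.comp adj₂) (pullback f f)) fun T t ht => by
    obtain ⟨l, rfl⟩ := hj.lift t (by rw [← hθ₁, reassoc_of% ht, zero_comp])
    rw [Category.assoc]
    refine (hiff l).1 ?_
    rw [← hj₂, Category.assoc, ← hθ₂, ← Category.assoc, ← Category.assoc, ht, zero_comp]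
  -- Since `v` lands in `ℬ`, it kills whatever `η¹` kills. Lifted along `θ` to `K[f]`, the element
  -- is then killed by the unit at the kernel pair of `f`, so it lies in `K₀` and dies in the
  -- quotient.
  have hW : ∀ ⦃T : 𝒜⦄ (t : T ⟶ pullback f p), t ≫ pullback.fst f p = 0 →
      t ≫ unitAt adj₁ (pullback f p) = 0 → t = 0 := by
    intro T t h₁ h₂
    have htv : t ≫ v = 0 := comp_eq_zero_of_comp_unitAt adj₁ (H.obj_mem_essImage _) v t h₂
    obtain ⟨l, hl⟩ := hj.lift (pullback.snd t θ) (by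
      rw [← hθ₁, ← pullback.condition_assoc, h₁, comp_zero])
    have h0 : l ≫ kernel.ι f ≫ q = 0 := (hiff l).2 (by
      rw [reassoc_of% hl, ← hv, ← pullback.condition_assoc, htv, comp_zero])
    rw [← cancel_epi (pullback.fst t θ), comp_zero, pullback.condition]
    apply pullback.hom_ext
    · rw [Category.assoc, hθ₁, ← hl, Category.assoc, hj₁, comp_zero, zero_comp]
    · rw [Category.assoc, hθ₂, ← hl, Category.assoc, reassoc_of% hj₂, h0, zero_comp]
  have hWmono : Mono (kernel.ι (unitAt adj₁ (pullback f p)) ≫ pullback.fst f p) :=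
    mono_of_kernel_trivial _ fun T t ht => by
      rw [← cancel_mono (kernel.ι _), zero_comp]
      exact hW _ (by rw [Category.assoc, ht]) (by rw [Category.assoc, kernel.condition, comp_zero])
  -- descent of triviality from the pullback along `f` to the pullback along `p`
  obtain ⟨Δ, hΔ₁, hΔ₂⟩ := exists_pullback_lift p p (𝟙 E) (𝟙 E) rfl
  obtain ⟨σ, hσ₁, hσ₂⟩ := exists_pullback_lift f p (𝟙 P) q (by rw [Category.id_comp, hqp])
  obtain ⟨φ, hφ₁, hφ₂⟩ := exists_pullback_lift p p (pullback.fst f p ≫ q) (pullback.snd f p)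
    (by rw [Category.assoc, hqp, pullback.condition])
  have hφ : IsRegularEpi φ := isRegularEpi_pullback_map p hqp φ hφ₁ hφ₂ hqreg
  have hσφ : σ ≫ φ = q ≫ Δ := by
    apply pullback.hom_ext
    · rw [Category.assoc, hφ₁, reassoc_of% hσ₁, Category.assoc, hΔ₁, Category.comp_id]
    · rw [Category.assoc, hφ₂, hσ₂, Category.assoc, hΔ₂, Category.comp_id]
  have hE : ∀ ⦃T : 𝒜⦄ (t : T ⟶ pullback p p), t ≫ pullback.fst p p = 0 →
      t ≫ unitAt adj₁ (pullback p p) = 0 → t = 0 := by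
    intro T t h₁ h₂
    -- The Birkhoff property lifts elements of `K[η¹]` along `φ`, which is why the descent is made
    -- for `η¹` and not for `η`. By `hWmono` such a lift is determined by its first projection, so
    -- it factors through `σ`; `φ` then sends it to the diagonal element at zero.
    obtain ⟨T', c, l, hc, hl₁, hl₂⟩ := exists_unitKernel_cover adj₁ hℬ φ t h₂
    have hl : l = (l ≫ pullback.fst f p) ≫ σ := by
      obtain ⟨a, ha⟩ := (IsKernelOf.kernel_ι (unitAt adj₁ (pullback f p))).lift l hl₁
      obtain ⟨b, hb⟩ := (IsKernelOf.kernel_ι (unitAt adj₁ (pullback f p))).lift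
        ((l ≫ pullback.fst f p) ≫ σ)
        (comp_unitAt_eq_zero adj₁ _ _ (comp_unitAt_eq_zero adj₁ _ _ hl₁))
      have hab : a = b := by
        rw [← cancel_mono (kernel.ι (unitAt adj₁ (pullback f p)) ≫ pullback.fst f p),
          reassoc_of% ha, reassoc_of% hb, hσ₁, Category.comp_id]
      rw [← hb, ← hab, ha]
    have h0 : l ≫ pullback.fst f p ≫ q = 0 := by
      rw [← hφ₁, reassoc_of% hl₂, h₁, comp_zero]
    rw [← cancel_epi c, comp_zero, ← hl₂, hl, Category.assoc, hσφ, Category.assoc,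
      reassoc_of% h0, zero_comp]
  obtain ⟨i, hi₁, hi₂⟩ := exists_pullback_lift p p 0 (kernel.ι p) (by simp)
  have hi := isKernelOf_pullback_fst p i hi₁ hi₂
  have := hi.mono
  refine ⟨isMonadicExtension_of_isRegularEpi p hpreg,
    isTrivialExtension_of_section _ hR _ Δ hΔ₁ fun T t h₁ h₂ => ?_⟩
  obtain ⟨l, rfl⟩ := hi.lift t h₁
  -- Since `K[p]` lies in the smaller subcategory, protoadditivity can be applied to its identity,
  -- which turns triviality for `η¹` into triviality for `η`.
  have hl := comp_eq_zero_of_isProtoadditive adj₁ adj₂ hℬ.toIsRegularEpiReflective hproto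
    (pullback.fst p p) Δ hΔ₁ hi hK (𝟙 _) (fun T t ht => by
      rw [Category.comp_id, ← cancel_mono i, zero_comp]
      exact hE _ (by rw [Category.assoc, hi₁, comp_zero]) (by rw [Category.assoc, ht]))
    l (by rw [← h₂, Category.assoc])
  rw [Category.comp_id] at hl
  rw [hl, zero_comp]

end HopfFormula

end

end SemiAbelianHopf

/-! ### The Hopf formula. -/

open SemiAbelianHopf in
theorem theorem7p5
    {𝒜 : Type*} [Category* 𝒜] [HasZeroMorphisms 𝒜] [SemiAbelian 𝒜]
    {ℬ : Type*} [Category* ℬ] [HasZeroMorphisms ℬ]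
    {ℱ : Type*} [Category* ℱ] [HasZeroMorphisms ℱ]
    {I : 𝒜 ⥤ ℬ} {H : ℬ ⥤ 𝒜} [H.Full] [H.Faithful] (adj₁ : I ⊣ H) (hℬ : IsBirkhoff adj₁)
    {F : ℬ ⥤ ℱ} {U : ℱ ⥤ ℬ} [U.Full] [U.Faithful] (adj₂ : F ⊣ U)
    (hℱ : IsRegularEpiReflective adj₂) (hadm : IsAdmissible adj₂) (hproto : IsProtoadditive F)
    {P B : 𝒜} (f : P ⟶ B) (hf : IsProjectivePresentation f) :
    (∃ (E : 𝒜) (p : E ⟶ B), IsWeaklyUniversalNormalExtension (adj₁.comp adj₂) p) ∧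
    ∃ (hle : hopfDenominator adj₁ (adj₁.comp adj₂) f ≤ hopfNumerator adj₁ (adj₁.comp adj₂) f)
      (_ : IsNormalMono (Subobject.ofLE _ _ hle)),
      ∀ ⦃E : 𝒜⦄ (p : E ⟶ B), IsWeaklyUniversalNormalExtension (adj₁.comp adj₂) p →
        Nonempty ((U ⋙ H).obj (galoisGroup (adj₁.comp adj₂) p) ≅
          cokernel (Subobject.ofLE _ _ hle)) := by
  obtain ⟨j, hj₁, hj₂⟩ := exists_pullback_lift f f 0 (kernel.ι f) (by simp)
  have hd := isKernelOf_closure_relativeCommutator adj₁ adj₂ hℬ.toIsRegularEpiReflective hproto f j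
    hj₁ hj₂
  set D := closure (adj₁.comp adj₂) (relativeCommutator.toKernel adj₁ f) with hD
  obtain ⟨E, q, hqreg, hq⟩ := exists_quotient_of_isNormalMono _
    (isNormalMono_of_isKernelOf (adj₁.comp adj₂) f hj₁ hj₂ hd)
  obtain ⟨p, hqp⟩ := exists_desc_of_kernel hq f
    (by rw [Category.assoc, kernel.condition, comp_zero])
  have hnormal := isNormalExtension_quotient adj₁ adj₂ hℬ hℱ hproto f hf.regularEpi hj₁ hj₂ hd q p
    hqp hq
  have hp : IsWeaklyUniversalNormalExtension (adj₁.comp adj₂) p :=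
    ⟨hnormal, fun E' p' hp' =>
      exists_fac_of_isNormalExtension (adj₁.comp adj₂) f hf hj₁ hj₂ hd q p hqp hq p' hp'⟩
  -- the denominator is the kernel of `q`
  have hden : IsKernelOf (hopfDenominator adj₁ (adj₁.comp adj₂) f).arrow q := by
    have hmk : hopfDenominator adj₁ (adj₁.comp adj₂) f = Subobject.mk (D.arrow ≫ kernel.ι f) := by
      rw [hopfDenominator, ← hD, ← Subobject.map_mk, Subobject.mk_arrow]
    rw [hmk]
    exact hq.of_iso (Subobject.underlyingIso _) _ (Subobject.underlyingIso_hom_comp_eq_mk _)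
  -- the numerator is the intersection of the kernels of `f` and of the unit
  have hnum : ∀ {T : 𝒜} (t : T ⟶ P), (hopfNumerator adj₁ (adj₁.comp adj₂) f).Factors t ↔
      t ≫ f = 0 ∧ t ≫ unitAt (adj₁.comp adj₂) P = 0 := by
    intro T t
    rw [hopfNumerator, Subobject.inf_factors, kernelSubobject_factors_iff,
      (isKernelOf_closure_selfCommutator adj₁ adj₂ P).factors_iff]
  have hunit : (D.arrow ≫ kernel.ι f) ≫ unitAt (adj₁.comp adj₂) P = 0 := by
    rw [← hj₂, Category.assoc, Category.assoc, ← unitAt_naturality, reassoc_of% hd.w, zero_comp]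
  -- Through `x`, the unit at `P` factors over `q`. As `x` has a reflected codomain, it kills
  -- `K[η_E]`; so every lift to `P` of an element of `K[p] ∧ K[η_E]` lies in the numerator, which is
  -- what makes `r` below a regular epimorphism.
  obtain ⟨x, hx⟩ := exists_desc_of_kernel hq _ hunit
  have hle : hopfDenominator adj₁ (adj₁.comp adj₂) f ≤ hopfNumerator adj₁ (adj₁.comp adj₂) f := by
    have hfac : ∀ {T : 𝒜} (t : T ⟶ P), t ≫ q = 0 →
        t ≫ f = 0 ∧ t ≫ unitAt (adj₁.comp adj₂) P = 0 := fun t ht =>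
      ⟨by rw [← hqp, reassoc_of% ht, zero_comp], by rw [← hx, reassoc_of% ht, zero_comp]⟩
    exact Subobject.le_of_comm (Subobject.factorThru _ _ ((hnum _).2 (hfac _ hden.w)))
      (Subobject.factorThru_arrow _ _ _)
  obtain ⟨n, hn⟩ := exists_isKernelMeet_galoisGroup (adj₁.comp adj₂) hnormal.trivial_pullback
  have := hn.mono
  obtain ⟨h₁, h₂⟩ := (hnum _).1 (Subobject.factors_self (hopfNumerator adj₁ (adj₁.comp adj₂) f))
  obtain ⟨r, hr⟩ := hn.lift ((hopfNumerator adj₁ (adj₁.comp adj₂) f).arrow ≫ q)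
    (by rw [Category.assoc, hqp, h₁]) (comp_unitAt_eq_zero _ _ _ h₂)
  have hrreg : IsRegularEpi r := by
    have hfac : (hopfNumerator adj₁ (adj₁.comp adj₂) f).Factors (pullback.snd n q) := by
      refine (hnum _).2 ⟨?_, ?_⟩
      · rw [← hqp, ← pullback.condition_assoc, hn.w₁, comp_zero]
      · rw [← hx, ← Category.assoc]
        exact comp_eq_zero_of_comp_unitAt (adj₁.comp adj₂) ((U ⋙ H).obj_mem_essImage _) x _ (by
          rw [← pullback.condition, Category.assoc, hn.w₂, comp_zero])
    refine isRegularEpi_of_comp (Subobject.factorThru _ _ hfac) r ?_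
    have : Subobject.factorThru _ _ hfac ≫ r = pullback.fst n q := by
      rw [← cancel_mono n, Category.assoc, hr, ← Category.assoc, Subobject.factorThru_arrow,
        pullback.condition]
    rw [this]
    infer_instance
  have hker : IsKernelOf (Subobject.ofLE _ _ hle) r := by
    refine ⟨inferInstance, ?_, fun T t ht => ?_⟩
    · rw [← cancel_mono n, Category.assoc, hr, ← Category.assoc, Subobject.ofLE_arrow, hden.w,
        zero_comp]
    · obtain ⟨l, hl⟩ := hden.lift (t ≫ (hopfNumerator adj₁ (adj₁.comp adj₂) f).arrow)
        (by rw [Category.assoc, ← hr, reassoc_of% ht, zero_comp])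
      exact ⟨l, by rw [← cancel_mono (Subobject.arrow _), Category.assoc, Subobject.ofLE_arrow, hl]⟩
  have hnorm := hker.isNormalMono
  refine ⟨⟨E, p, hp⟩, hle, hnorm, fun E' p' hp' => ?_⟩
  obtain ⟨n', hn'⟩ := exists_isKernelMeet_galoisGroup (adj₁.comp adj₂) hp'.normal.trivial_pullback
  obtain ⟨i⟩ := nonempty_iso_of_isWeaklyUniversal (adj₁.comp adj₂) hp' hp hn' hn
  obtain ⟨i'⟩ := nonempty_iso_cokernel hrreg hker
  exact ⟨i ≪≫ i'⟩
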